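/- Let $\mathbb{P}^1=\mathbb{C}\cup\{\infty\}$. For $\tau$ in the upper half plane $\mathbb{H}$ put $\Lambda_{1,\tau}=\mathbb{Z}+\mathbb{Z}\tau$ and $E_\tau=\mathbb{C}/\Lambda_{1,\tau}$, and let $\wp_\tau\colon E_\tau\to\mathbb{P}^1$ be the Weierstrass function of $\Lambda_{1,\tau}$. For an integer $n\ge 1$ let $[n]\colon E_\tau\to E_{n\tau}$ be the isogeny induced by $z\mapsto nz$. Call rational functions $f,g\in\mathbb{C}(z)$, regarded as maps $\mathbb{P}^1\to\mathbb{P}^1$, equivalent, $f\sim g$, if $g=\varepsilon\circ f\circ\iota^{-1}$ for some Möbius transformations $\varepsilon,\iota\in\mathrm{Aut}(\mathbb{P}^1)$. (1) For all $n\ge 1$ and $\tau\in\mathbb{H}$ there is a unique rational function $n_\tau$ with $n_\tau\circ\wp_\tau=\wp_{n\tau}\circ[n]$, and it has degree $n$. (2) For all $n\ge 3$ and $\tau_1,\tau_2\in\mathbb{H}$, one has $n_{\tau_1}\sim n_{\tau_2}$ if and only if $\Gamma_0(n)\tau_2=\Gamma_0(n)\tau_1$, where $\Gamma_0(n)=\left\{\begin{pmatrix}a&b\\c&d\end{pmatrix}\in\mathrm{SL}_2(\mathbb{Z})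 : c\equiv 0 \pmod n\right\}$ acts on $\mathbb{H}$ by $\tau\mapsto\frac{a\tau+b}{c\tau+d}$. (3) Call a rational function elliptic if it is equivalent to $m_\tau$ for some $m\ge 1$ and $\tau\in\mathbb{H}$. For every $n\ge 3$, the assignment $\Gamma_0(n)\tau\mapsto[n_\tau]$ is a well-defined bijection from $Y_0(n)=\Gamma_0(n)\backslash\mathbb{H}$ onto the set of equivalence classes of elliptic rational functions of degree $n$. -/

import Mathlib

open scoped UpperHalfPlane

noncomputable section

namespace EllipticRational

/-! ### Rational functions as self-maps of the Riemann sphere `ℙ¹ = ℂ ∪ {∞}` -/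

/-- The self-map of `ℙ¹ = ℂ ∪ {∞}` defined by a rational function `f = p / q` in lowest terms with
`q` monic.  A finite point `x` goes to `∞` if `q x = 0` and to `p x / q x` otherwise; the point `∞`
goes to `∞` if `deg p > deg q`, and otherwise to the coefficient of `X ^ deg q` in `p`, which is
the limit of `p / q` at infinity. -/
def sphereMap (f : RatFunc ℂ) : OnePoint ℂ → OnePoint ℂ
  | OnePoint.infty =>
      if f.denom.natDegree < f.num.natDegree then OnePoint.infty
      else ((f.num.coeff f.denom.natDegree : ℂ) : OnePoint ℂ)
  | OnePoint.some x =>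
      if f.denom.eval x = 0 then OnePoint.infty
      else ((f.num.eval x / f.denom.eval x : ℂ) : OnePoint ℂ)

/-- The degree of a rational function `p / q` in lowest terms, `max (deg p) (deg q)`. -/
def ratDegree (f : RatFunc ℂ) : ℕ := max f.num.natDegree f.denom.natDegree

/-- Equivalence of rational functions: `g = ε ∘ f ∘ ι⁻¹` with `ε, ι ∈ Aut(ℙ¹)`, written as
`g ∘ ι = ε ∘ f`.  The automorphisms of `ℙ¹` are the Möbius transformations, given by Mathlib's
action of `GL₂(ℂ)` on `OnePoint ℂ`. -/
def MobiusEquiv (f g : RatFunc ℂ) : Prop :=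
  ∃ ε ι : GL (Fin 2) ℂ, ∀ x : OnePoint ℂ, sphereMap g (ι • x) = ε • sphereMap f x

theorem mobiusEquiv_equivalence : Equivalence MobiusEquiv where
  refl f := ⟨1, 1, fun x => by simp⟩
  symm := by
    rintro f g ⟨ε, ι, h⟩
    refine ⟨ε⁻¹, ι⁻¹, fun x => ?_⟩
    have := h (ι⁻¹ • x)
    rw [smul_inv_smul] at this
    rw [this, inv_smul_smul]
  trans := by
    rintro f g k ⟨ε, ι, h⟩ ⟨ε', ι', h'⟩
    refine ⟨ε' * ε, ι' * ι, fun x => ?_⟩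
    rw [mul_smul, mul_smul, h', h]

/-- Rational functions up to Möbius equivalence. -/
def mobiusSetoid : Setoid (RatFunc ℂ) := ⟨MobiusEquiv, mobiusEquiv_equivalence⟩

/-! ### The elliptic curves `E_τ = ℂ / Λ_{1,τ}` and the isogenies `[n] : E_τ → E_{nτ}` -/

/-- The pair of periods `(1, τ)`. -/
def periods (τ : ℍ) : PeriodPair where
  ω₁ := 1
  ω₂ := τ
  indep := by
    rw [LinearIndependent.pair_iff]
    intro s t h
    have him := congrArg Complex.im h
    have hre := congrArg Complex.re h
    have hτ : τ.im ≠ 0 := τ.im_pos.ne'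
    have ht : t = 0 := by simpa [hτ] using him
    subst ht
    exact ⟨by simpa using hre, rfl⟩

/-- The elliptic curve `E_τ = ℂ / Λ_{1,τ}`, where `Λ_{1,τ} = ℤ + ℤ τ`. -/
abbrev EllCurve (τ : ℍ) : Type := ℂ ⧸ (periods τ).lattice

/-- The point `n τ` of the upper half plane. -/
def mulTau (n : ℕ+) (τ : ℍ) : ℍ :=
  ⟨(n : ℂ) * τ, by
    have h : (0 : ℝ) < n := by exact_mod_cast n.pos
    have := mul_pos h τ.im_pos
    simpa using this⟩

theorem lattice_le_comap (n : ℕ+) (τ : ℍ) :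
    (periods τ).lattice ≤
      (periods (mulTau n τ)).lattice.comap (LinearMap.mulLeft ℤ (n : ℂ)) := by
  rw [PeriodPair.lattice, Submodule.span_le]
  rintro x (rfl | rfl)
  · change (n : ℂ) * 1 ∈ (periods (mulTau n τ)).lattice
    have := (periods (mulTau n τ)).lattice.smul_mem ((n : ℕ) : ℤ)
      (periods (mulTau n τ)).ω₁_mem_lattice
    simpa [periods] using this
  · exact (periods (mulTau n τ)).ω₂_mem_lattice

/-- The cyclic isogeny `[n] : E_τ → E_{nτ}` induced by `z ↦ n z`. -/
def isogeny (n : ℕ+) (τ : ℍ) : EllCurve τ →ₗ[ℤ] EllCurve (mulTau n τ) :=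
  Submodule.mapQ _ _ (LinearMap.mulLeft ℤ (n : ℂ)) (lattice_le_comap n τ)

open Classical in
/-- The Weierstrass function with periods `1, τ` as a map `ℂ → ℙ¹`, with value `∞` at its poles. -/
def wpLift (τ : ℍ) (z : ℂ) : OnePoint ℂ :=
  if z ∈ (periods τ).lattice then OnePoint.infty
  else (((periods τ).weierstrassP z : ℂ) : OnePoint ℂ)

theorem wpLift_eq_of_sub_mem (τ : ℍ) (z w : ℂ) (h : z - w ∈ (periods τ).lattice) :
    wpLift τ z = wpLift τ w := by
  have h1 : z ∈ (periods τ).lattice ↔ w ∈ (periods τ).lattice := by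
    constructor
    · intro hz
      simpa using sub_mem hz h
    · intro hw
      simpa using add_mem h hw
  have h2 := (periods τ).weierstrassP_add_coe w ⟨z - w, h⟩
  simp only [add_sub_cancel] at h2
  unfold wpLift
  rw [h2]
  by_cases hw : w ∈ (periods τ).lattice
  · rw [if_pos hw, if_pos (h1.2 hw)]
  · rw [if_neg hw, if_neg (fun hz => hw (h1.1 hz))]

/-- The Weierstrass function `℘_τ : E_τ → ℙ¹`. -/
def wp (τ : ℍ) : EllCurve τ → OnePoint ℂ :=
  Quotient.lift (wpLift τ) fun z w h =>
    wpLift_eq_of_sub_mem τ z w ((Submodule.quotientRel_def _).1 h)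

/-! ### The rational functions `n_τ` -/

/-- The rational function `f` is the descent of `[n] : E_τ → E_{nτ}` along the Weierstrass
functions, that is, `f ∘ ℘_τ = ℘_{nτ} ∘ [n]`. -/
def IsDescent (n : ℕ+) (τ : ℍ) (f : RatFunc ℂ) : Prop :=
  ∀ P : EllCurve τ, sphereMap f (wp τ P) = wp (mulTau n τ) (isogeny n τ P)

/-- The rational function `n_τ`, i.e. the descent of `[n] : E_τ → E_{nτ}`. -/
def descent (n : ℕ+) (τ : ℍ) : RatFunc ℂ := Classical.epsilon (IsDescent n τ)

/-- An elliptic rational function is one that is Möbius equivalent to some `m_τ`. -/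
def IsElliptic (f : RatFunc ℂ) : Prop :=
  ∃ (m : ℕ+) (τ : ℍ), MobiusEquiv f (descent m τ)

/-- The set of elliptic rational functions of degree `n`, up to Möbius equivalence. -/
def ellipticClasses (n : ℕ) : Set (Quotient mobiusSetoid) :=
  Quotient.mk mobiusSetoid '' {f : RatFunc ℂ | IsElliptic f ∧ ratDegree f = n}

/-- The (open) modular curve `Y₀(n) = Γ₀(n) \ ℍ`, as a set. -/
abbrev Y0 (n : ℕ) : Type := MulAction.orbitRel.Quotient (CongruenceSubgroup.Gamma0 n) ℍ

end EllipticRational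

end

noncomputable section

namespace EllipticRational

open Filter Topology PeriodPair

/-! Existence of `n_τ`: the functions `n² ℘_{nτ}(nz)` and `∑_{k<n} ℘_τ(z - k/n)` have the same
principal parts, so by Liouville they differ by a constant. Averaging over `z` and `-z` turns the
sum into terms `℘(z+u) + ℘(z-u)`, each rational in `℘(z)` (`exists_sq_mul_symmSum_eq`, used in
`isRationalInP_mul`). Uniqueness is the surjectivity of `℘`. As `℘` is injective up to sign and
periods (`toSphere_eq_iff`), the fibre of `n_τ` over `℘_{nτ}(v)` consists of the points
`℘_τ((v+k)/n)` with `k < n` (`descent_fibre`). These are distinct unless `2v ∈ Λ_{1,nτ}`, which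
gives the degree.

For `n ≥ 3` the values with fewer than `n` preimages are exactly the images of the 2-torsion points
of `E_{nτ}` (`mem_branchSet_iff`). Hence, if `n_{τ₂} ∘ ι = ε ∘ n_{τ₁}`, then `ε` sends branch values
to branch values. It therefore lifts to an affine map `z ↦ αz + β`, because `ε ∘ ℘` satisfies a
rescaled Weierstrass equation (`exists_affine_lift`). The fibre formula lifts `ι` with the same `α`.
Comparing periods, `α` carries `Λ_{1,τ₁}` onto `Λ_{1,τ₂}` and `Λ_{1,nτ₁}` onto `Λ_{1,nτ₂}`, and the
change of basis is then a matrix in `Γ₀(n)` (`mem_orbit_of_homothety`). Conversely, a matrix in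
`Γ₀(n)` provides such an `α`, and the homogeneity of `℘` makes `x ↦ α⁻² x` an equivalence
(`mobiusEquiv_of_mem_orbit`).

For the bijection it remains that the degree is a Möbius invariant, being the size of a generic
fibre (`MobiusEquiv.ratDegree_eq`). Many identities are proved only off a countable set; its
complement in `ℂ` is connected and dense, which suffices for the identity theorem and for continuity
arguments. -/

/-! ### Functions with at most a double pole without residue -/

/-- Near `z₀` the function `f` is `a / (z - z₀) ^ 2` plus an analytic function. -/
def HasDoublePole (f : ℂ → ℂ) (z₀ a : ℂ) : Prop :=
  ∃ g : ℂ → ℂ, AnalyticAt ℂ g z₀ ∧ f =ᶠ[𝓝[≠] z₀] fun z => a / (z - z₀) ^ 2 + g z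

theorem AnalyticAt.hasDoublePole {f : ℂ → ℂ} {z₀ : ℂ} (hf : AnalyticAt ℂ f z₀) :
    HasDoublePole f z₀ 0 :=
  ⟨f, hf, by simp⟩

namespace HasDoublePole

variable {f f' : ℂ → ℂ} {z₀ a a' : ℂ}

theorem add (h : HasDoublePole f z₀ a) (h' : HasDoublePole f' z₀ a') :
    HasDoublePole (fun z => f z + f' z) z₀ (a + a') := by
  obtain ⟨g, hg, e⟩ := h
  obtain ⟨g', hg', e'⟩ := h'
  refine ⟨fun z => g z + g' z, hg.add hg', ?_⟩
  filter_upwards [e, e'] with z hz hz'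
  rw [hz, hz']
  ring

theorem const_mul (c : ℂ) (h : HasDoublePole f z₀ a) :
    HasDoublePole (fun z => c * f z) z₀ (c * a) := by
  obtain ⟨g, hg, e⟩ := h
  refine ⟨fun z => c * g z, analyticAt_const.mul hg, ?_⟩
  filter_upwards [e] with z hz
  rw [hz]
  ring

theorem sub (h : HasDoublePole f z₀ a) (h' : HasDoublePole f' z₀ a') :
    HasDoublePole (fun z => f z - f' z) z₀ (a - a') := by
  simpa [sub_eq_add_neg] using h.add (h'.const_mul (-1))

theorem sum {ι : Type*} (s : Finset ι) {f : ι → ℂ → ℂ} {a : ι → ℂ}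
    (h : ∀ i ∈ s, HasDoublePole (f i) z₀ (a i)) :
    HasDoublePole (fun z => ∑ i ∈ s, f i z) z₀ (∑ i ∈ s, a i) := by
  classical
  induction s using Finset.induction_on with
  | empty => simpa using AnalyticAt.hasDoublePole (f := fun _ => (0 : ℂ)) analyticAt_const
  | insert i s hi ih =>
    simp only [Finset.sum_insert hi]
    exact (h i (by simp)).add (ih fun j hj => h j (by simp [hj]))

theorem comp_affine {c d : ℂ} (hc : c ≠ 0) (h : HasDoublePole f (c * z₀ + d) a) :
    HasDoublePole (fun z => f (c * z + d)) z₀ (a / c ^ 2) := by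
  obtain ⟨g, hg, e⟩ := h
  have hA : AnalyticAt ℂ (fun z => c * z + d) z₀ := by fun_prop
  refine ⟨fun z => g (c * z + d), AnalyticAt.fun_comp hg hA, ?_⟩
  have ht : Tendsto (fun z => c * z + d) (𝓝[≠] z₀) (𝓝[≠] (c * z₀ + d)) := by
    refine tendsto_nhdsWithin_of_tendsto_nhds_of_eventually_within _
      (hA.continuousAt.tendsto.mono_left nhdsWithin_le_nhds) ?_
    filter_upwards [self_mem_nhdsWithin] with z hz hz'
    exact hz (mul_left_cancel₀ hc (add_right_cancel hz'))
  filter_upwards [ht.eventually e] with z hz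
  rw [hz, show c * z + d - (c * z₀ + d) = c * (z - z₀) by ring, mul_pow, div_div]

theorem tendsto (h : HasDoublePole f z₀ a) :
    Tendsto (fun z => (z - z₀) ^ 2 * f z) (𝓝[≠] z₀) (𝓝 a) := by
  obtain ⟨g, hg, e⟩ := h
  have h1 : Tendsto (fun z => a + (z - z₀) ^ 2 * g z) (𝓝[≠] z₀) (𝓝 a) := by
    have : ContinuousAt (fun z => a + (z - z₀) ^ 2 * g z) z₀ := by
      have := hg.continuousAt
      fun_prop
    simpa using this.tendsto.mono_left nhdsWithin_le_nhds
  refine h1.congr' ?_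
  filter_upwards [e, self_mem_nhdsWithin] with z hz hz'
  have : z - z₀ ≠ 0 := sub_ne_zero.2 hz'
  rw [hz]
  field_simp

theorem unique (h : HasDoublePole f z₀ a) (h' : HasDoublePole f z₀ a') : a = a' :=
  tendsto_nhds_unique h.tendsto h'.tendsto

theorem congr (h : HasDoublePole f z₀ a) (e : f' =ᶠ[𝓝[≠] z₀] f) : HasDoublePole f' z₀ a := by
  obtain ⟨g, hg, e'⟩ := h
  exact ⟨g, hg, e.trans e'⟩

/-- The square of a function vanishing at `z₀` vanishes there to order at least two and absorbs the
pole; `dslope` is the quotient of `k` by `z - z₀`. -/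
theorem sq_mul {k : ℂ → ℂ} (h : HasDoublePole f z₀ a) (hk : AnalyticAt ℂ k z₀)
    (hk0 : k z₀ = 0) : HasDoublePole (fun z => k z ^ 2 * f z) z₀ 0 := by
  obtain ⟨g, hg, e⟩ := h
  obtain ⟨p, hp⟩ := hk
  have hd : AnalyticAt ℂ (dslope k z₀) z₀ := ⟨_, hp.has_fpower_series_dslope_fslope⟩
  have hk : AnalyticAt ℂ k z₀ := ⟨p, hp⟩
  refine ⟨fun z => a * dslope k z₀ z ^ 2 + k z ^ 2 * g z, by fun_prop, ?_⟩
  filter_upwards [e, self_mem_nhdsWithin] with z hz hz'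
  have h0 : z - z₀ ≠ 0 := sub_ne_zero.2 hz'
  have h1 : k z = (z - z₀) * dslope k z₀ z := by
    simpa [hk0] using (sub_smul_dslope k z₀ z).symm
  rw [hz]
  simp only [h1, zero_div, zero_add]
  field_simp

end HasDoublePole

/-- Liouville's theorem: an elliptic function with removable singularities is constant. -/
theorem eventuallyEq_const_of_periodic (L : PeriodPair) {f : ℂ → ℂ}
    (hper : ∀ l ∈ L.lattice, ∀ z, f (z + l) = f z) (h : ∀ z, HasDoublePole f z 0) :
    ∃ c, ∀ z, f =ᶠ[𝓝[≠] z] fun _ => c := by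
  choose g hg e using h
  simp only [zero_div, zero_add] at e
  have hlim (z) : Tendsto f (𝓝[≠] z) (𝓝 (g z z)) :=
    ((hg z).continuousAt.tendsto.mono_left nhdsWithin_le_nhds).congr' (e z).symm
  -- The local analytic extensions `g z` glue to the entire function `w ↦ g w w`: both sides are the
  -- limit of `f` over the punctured neighbourhood of `w`.
  have hG (z) : (fun w => g w w) =ᶠ[𝓝 z] g z := by
    filter_upwards [(hg z).eventually_analyticAt,
      eventually_eventually_nhds.2 (eventually_nhdsWithin_iff.1 (e z))] with w hw hw'
    rcases eq_or_ne w z with rfl | hne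
    · rfl
    refine tendsto_nhds_unique (hlim w)
      ((hw.continuousAt.tendsto.mono_left nhdsWithin_le_nhds).congr' ?_)
    filter_upwards [nhdsWithin_le_nhds hw', nhdsWithin_le_nhds (isOpen_ne.mem_nhds hne)]
      with x hx hx'
    exact (hx hx').symm
  have hd : Differentiable ℂ fun w => g w w := fun z =>
    ((hg z).congr (hG z).symm).differentiableAt
  have hp (z l : ℂ) (hl : l ∈ L.lattice) : g (z + l) (z + l) = g z z := by
    refine tendsto_nhds_unique ?_ (hlim z)
    have ht : Tendsto (fun w => w + l) (𝓝[≠] z) (𝓝[≠] (z + l)) := by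
      refine tendsto_nhdsWithin_of_tendsto_nhds_of_eventually_within _
        (Continuous.tendsto (by fun_prop) z |>.mono_left nhdsWithin_le_nhds) ?_
      filter_upwards [self_mem_nhdsWithin] with w hw hw'
      exact hw (add_right_cancel hw')
    exact ((hlim (z + l)).comp ht).congr fun w => hper l hl w
  refine ⟨g 0 0, fun z => ?_⟩
  have hb := IsZLattice.isCompact_range_of_periodic L.lattice _ hd.continuous
    fun z w hw => hp z w hw
  filter_upwards [e z, nhdsWithin_le_nhds (hG z)] with w hw hw'
  rw [hw, ← hw']
  exact hd.apply_eq_apply_of_bounded hb.isBounded w 0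

/-! ### The Weierstrass function of a lattice -/

section Weierstrass

variable (L : PeriodPair)

open Classical in
-- `weierstrassPExcept` omits the summand of the lattice point `z₀`. For `z₀ = 0` the correction `1
-- / z₀ ^ 2` is zero by the convention on division.
theorem hasDoublePole_weierstrassP (z₀ : ℂ) :
    HasDoublePole (weierstrassP L) z₀ (if z₀ ∈ L.lattice then 1 else 0) := by
  split_ifs with h
  · refine ⟨fun z => L.weierstrassPExcept z₀ z - 1 / z₀ ^ 2,
      (L.analyticAt_weierstrassPExcept z₀).sub analyticAt_const, .of_forall fun z => ?_⟩
    have := L.weierstrassPExcept_add ⟨z₀, h⟩ z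
    simp only at this
    rw [← this]
    ring
  · exact AnalyticAt.hasDoublePole (L.analyticOnNhd_weierstrassP z₀ h)

theorem countable_lattice : (L.lattice : Set ℂ).Countable :=
  countable_of_Lindelof_of_discrete (X := L.lattice)

theorem eventually_notMem_lattice (z : ℂ) : ∀ᶠ w in 𝓝[≠] z, w ∉ L.lattice := by
  filter_upwards [self_mem_nhdsWithin, mem_nhdsWithin_of_mem_nhds
    (L.compl_lattice_sdiff_singleton_mem_nhds z)] with w hw hw' hw''
  exact hw' ⟨hw'', hw⟩

theorem tendsto_weierstrassP_cobounded {l : ℂ} (hl : l ∈ L.lattice) :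
    Tendsto (weierstrassP L) (𝓝[≠] l) (Bornology.cobounded ℂ) :=
  tendsto_cobounded_of_meromorphicOrderAt_neg (by rw [L.order_weierstrassP l hl]; decide)

/-- The Weierstrass function takes every finite value. -/
theorem exists_weierstrassP_eq (c : ℂ) : ∃ z ∉ L.lattice, weierstrassP L z = c := by
  by_contra! hc
  -- If `℘` omits `c`, then `(℘ - c)⁻¹` is elliptic without poles, hence constant. It tends to `0`
  -- at the lattice points, so it would be zero.
  have hper : ∀ l ∈ L.lattice, ∀ z, (weierstrassP L (z + l) - c)⁻¹ = (weierstrassP L z - c)⁻¹ :=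
    fun l hl z => by rw [L.weierstrassP_add_coe z ⟨l, hl⟩]
  have hlim {l : ℂ} (hl : l ∈ L.lattice) :
      Tendsto (fun z => (weierstrassP L z - c)⁻¹) (𝓝[≠] l) (𝓝 0) :=
    (tendsto_inv₀_cobounded.comp (tendsto_sub_const_cobounded c)).comp
      (tendsto_weierstrassP_cobounded L hl)
  have hreg : ∀ z, HasDoublePole (fun z => (weierstrassP L z - c)⁻¹) z 0 := by
    intro z
    by_cases hz : z ∈ L.lattice
    · have hm : MeromorphicAt (fun z => (weierstrassP L z - c)⁻¹) z :=
        ((L.meromorphic_weierstrassP z).sub (.const c z)).inv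
      have ho : 0 ≤ meromorphicOrderAt (fun z => (weierstrassP L z - c)⁻¹) z :=
        ((tendsto_zero_iff_meromorphicOrderAt_pos hm).1 (hlim hz)).le
      obtain ⟨g, hg, e⟩ := (MeromorphicAt.meromorphicOrderAt_nonneg_iff hm).1 ho
      exact ⟨g, hg, by simpa using e⟩
    · exact AnalyticAt.hasDoublePole
        (((L.analyticOnNhd_weierstrassP z hz).sub analyticAt_const).inv
          (sub_ne_zero.2 (hc z hz)))
  obtain ⟨c', hc'⟩ := eventuallyEq_const_of_periodic L hper hreg
  have h0 : c' = 0 :=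
    tendsto_nhds_unique (tendsto_const_nhds.congr' (hc' 0).symm) (hlim (zero_mem _))
  obtain ⟨z, hz, hz'⟩ := ((hc' 0).and (eventually_notMem_lattice L 0)).exists
  rw [h0] at hz
  exact hc z hz' (sub_eq_zero.1 (inv_eq_zero.1 hz))

theorem isPreconnected_compl_of_countable {s : Set ℂ} (hs : s.Countable) : IsPreconnected sᶜ :=
  (hs.isConnected_compl_of_one_lt_rank (by simp)).isPreconnected

/-- The Weierstrass function takes a given value only at isolated points. -/
theorem eventually_weierstrassP_ne (c : ℂ) (u : ℂ) : ∀ᶠ z in 𝓝[≠] u, weierstrassP L z ≠ c := by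
  by_cases hu : u ∈ L.lattice
  · exact (tendsto_weierstrassP_cobounded L hu).eventually 
      (Bornology.isBounded_def.1 (Bornology.isBounded_singleton (x := c)))
  · by_contra hf
    -- Otherwise `℘` would be constantly `c` off the lattice, and could not take the value `c + 1`.
    have hf' : ∃ᶠ z in 𝓝[≠] u, weierstrassP L z = (fun _ => c) z := by
      exact hf
    have := L.analyticOnNhd_weierstrassP.eqOn_of_preconnected_of_frequently_eq
      (fun z _ => analyticAt_const)
      (isPreconnected_compl_of_countable (countable_lattice L)) hu hf'
    obtain ⟨z, hz, hz'⟩ := exists_weierstrassP_eq L (c + 1)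
    simpa [hz'] using this hz

/-! ### The symmetrized addition formula and the injectivity of `℘` up to sign -/

theorem exists_even_quotient {h : ℂ → ℂ} (hh : AnalyticAt ℂ h 0) (he : ∀ z, h (-z) = h z) :
    ∃ k : ℂ → ℂ, AnalyticAt ℂ k 0 ∧ (∀ z, k (-z) = k z) ∧ ∀ z, h z = h 0 + z ^ 2 * k z := by
  obtain ⟨p, hp⟩ := hh
  -- The derivative of an even function vanishes at `0`, so one can divide by `z` twice.
  have hd0 : dslope h 0 0 = 0 := by
    have h1 : deriv (fun z => h (-z)) 0 = -deriv h 0 := by simpa using deriv_comp_neg h 0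
    rw [funext he] at h1
    rw [dslope_same]
    exact CharZero.eq_neg_self_iff.1 h1
  have hz (z : ℂ) : h z - h 0 = z * dslope h 0 z := by
    simpa using (sub_smul_dslope h 0 z).symm
  have hz' (z : ℂ) : dslope h 0 z = z * dslope (dslope h 0) 0 z := by
    have := sub_smul_dslope (dslope h 0) 0 z
    rw [hd0, sub_zero, sub_zero, smul_eq_mul] at this
    exact this.symm
  refine ⟨dslope (dslope h 0) 0,
    ⟨_, hp.has_fpower_series_dslope_fslope.has_fpower_series_dslope_fslope⟩, fun z => ?_,
    fun z => ?_⟩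
  · rcases eq_or_ne z 0 with rfl | h0
    · simp
    · have h1 := hz z
      have h2 := hz (-z)
      rw [he] at h2
      rw [hz'] at h1 h2
      have : z ^ 2 * dslope (dslope h 0) 0 (-z) = z ^ 2 * dslope (dslope h 0) 0 z := by
        linear_combination h1 - h2
      exact mul_left_cancel₀ (pow_ne_zero 2 h0) this
  · linear_combination hz z + z * hz' z

/-- The symmetrization `℘ (z + u) + ℘ (z - u) - 2 ℘ u`. -/
def symmSum (u z : ℂ) : ℂ :=
  weierstrassP L (z + u) + weierstrassP L (z - u) - 2 * weierstrassP L u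

theorem symmSum_neg (u z : ℂ) : symmSum L u (-z) = symmSum L u z := by
  unfold symmSum
  rw [show -z + u = -(z - u) by ring, show -z - u = -(z + u) by ring, L.weierstrassP_neg,
    L.weierstrassP_neg]
  ring

theorem symmSum_add_coe (u z l : ℂ) (hl : l ∈ L.lattice) :
    symmSum L u (z + l) = symmSum L u z := by
  unfold symmSum
  rw [show z + l + u = z + u + l by ring, show z + l - u = z - u + l by ring,
    L.weierstrassP_add_coe _ ⟨l, hl⟩, L.weierstrassP_add_coe _ ⟨l, hl⟩]

theorem analyticAt_symmSum {u z : ℂ} (h1 : z + u ∉ L.lattice) (h2 : z - u ∉ L.lattice) :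
    AnalyticAt ℂ (symmSum L u) z := by
  have h3 : AnalyticAt ℂ (fun z => weierstrassP L (z + u)) z :=
    AnalyticAt.fun_comp (L.analyticOnNhd_weierstrassP _ h1) (by fun_prop)
  have h4 : AnalyticAt ℂ (fun z => weierstrassP L (z - u)) z :=
    AnalyticAt.fun_comp (L.analyticOnNhd_weierstrassP _ h2) (by fun_prop)
  exact (h3.add h4).sub analyticAt_const

open Classical in
theorem hasDoublePole_symmSum (u z : ℂ) :
    HasDoublePole (symmSum L u) z
      ((if z + u ∈ L.lattice then 1 else 0) + (if z - u ∈ L.lattice then 1 else 0)) := by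
  have h1 := HasDoublePole.comp_affine (z₀ := z) (c := 1) (d := u) one_ne_zero
    (hasDoublePole_weierstrassP L _)
  have h2 := HasDoublePole.comp_affine (z₀ := z) (c := 1) (d := -u) one_ne_zero
    (hasDoublePole_weierstrassP L _)
  have h3 := (h1.add h2).sub (AnalyticAt.hasDoublePole
    (f := fun _ => 2 * weierstrassP L u) analyticAt_const)
  simp only [one_mul, one_pow, div_one, sub_zero, ← sub_eq_add_neg] at h3
  exact h3

/-- `symmSum` is even and vanishes at `0`, so it is `z² (k 0 + z² m z)`. Against the pole of order
four of `(℘ z - ℘ u)²` this leaves `k 0 / z²` and no term in `1 / z`. -/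
theorem exists_hasDoublePole_sq_mul_symmSum_zero {u : ℂ} (hu : u ∉ L.lattice) :
    ∃ a, HasDoublePole (fun z => (weierstrassP L z - weierstrassP L u) ^ 2 * symmSum L u z) 0 a := by
  have hS : AnalyticAt ℂ (symmSum L u) 0 :=
    analyticAt_symmSum L (by simpa using hu) (by simpa using hu)
  obtain ⟨k, hk, hke, hk'⟩ := exists_even_quotient hS (symmSum_neg L u)
  obtain ⟨m, hm, -, hm'⟩ := exists_even_quotient hk hke
  have hS0 : symmSum L u 0 = 0 := by
    simp [symmSum, L.weierstrassP_neg]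
    ring
  obtain ⟨g, hg, e⟩ := hasDoublePole_weierstrassP L 0
  rw [if_pos (zero_mem _)] at e
  refine ⟨k 0, fun z => m z * (1 + z ^ 2 * (g z - weierstrassP L u)) ^ 2 +
    k 0 * (2 * (g z - weierstrassP L u) + z ^ 2 * (g z - weierstrassP L u) ^ 2),
    by fun_prop, ?_⟩
  filter_upwards [e, self_mem_nhdsWithin] with z hz hz0
  have hz0 : z ≠ 0 := hz0
  rw [hz, hk', hm', hS0]
  field_simp
  ring

/-- `(℘ z - ℘ u) ^ 2 * (℘ (z + u) + ℘ (z - u) - 2 ℘ u)` is an affine function of `℘ z`. -/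
theorem exists_sq_mul_symmSum_eq {u : ℂ} (hu : u ∉ L.lattice) :
    ∃ a b : ℂ, ∀ z, z ∉ L.lattice → z + u ∉ L.lattice → z - u ∉ L.lattice →
      (weierstrassP L z - weierstrassP L u) ^ 2 * symmSum L u z = a * weierstrassP L z + b := by
  obtain ⟨a, ha⟩ := exists_hasDoublePole_sq_mul_symmSum_zero L hu
  have hreg : ∀ z, HasDoublePole (fun z =>
      (weierstrassP L z - weierstrassP L u) ^ 2 * symmSum L u z - a * weierstrassP L z) z 0 := by
    intro z
    by_cases hz : z ∈ L.lattice
    · have h0 := ha.sub ((hasDoublePole_weierstrassP L 0).const_mul a)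
      rw [if_pos (zero_mem _), mul_one, sub_self] at h0
      have h1 := HasDoublePole.comp_affine (z₀ := z) (c := 1) (d := -z) (a := 0) one_ne_zero
        (by simpa using h0)
      simpa [← sub_eq_add_neg, L.weierstrassP_sub_coe _ ⟨z, hz⟩,
        ← symmSum_add_coe L u (_ - z) z hz] using h1
    · have hw := L.analyticOnNhd_weierstrassP z hz
      have h2 : HasDoublePole (fun z =>
          (weierstrassP L z - weierstrassP L u) ^ 2 * symmSum L u z) z 0 := by
        -- Off the lattice, the poles of `symmSum` lie where `℘ z = ℘ u`; there the squared factor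
        -- cancels them.
        by_cases hzu : weierstrassP L z = weierstrassP L u
        · exact (hasDoublePole_symmSum L u z).sq_mul (hw.sub analyticAt_const)
            (by simp [hzu])
        · refine AnalyticAt.hasDoublePole (((hw.sub analyticAt_const).pow 2).mul
            (analyticAt_symmSum L (fun h => hzu ?_) fun h => hzu ?_))
          · have := L.weierstrassP_add_coe (-u) ⟨z + u, h⟩
            simpa [L.weierstrassP_neg] using this
          · have := L.weierstrassP_add_coe u ⟨z - u, h⟩
            simpa using this
      simpa using h2.sub ((AnalyticAt.hasDoublePole hw).const_mul a)
  obtain ⟨b, hb⟩ := eventuallyEq_const_of_periodic L (fun l hl z => by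
    simp only [symmSum_add_coe L u z l hl, L.weierstrassP_add_coe z ⟨l, hl⟩]) hreg
  refine ⟨a, b, fun z hz h1 h2 => ?_⟩
  have hw := L.analyticOnNhd_weierstrassP z hz
  have hs := analyticAt_symmSum L h1 h2
  have hc : ContinuousAt (fun z =>
      (weierstrassP L z - weierstrassP L u) ^ 2 * symmSum L u z - a * weierstrassP L z) z := by
    have := hw.continuousAt
    have := hs.continuousAt
    fun_prop
  have := tendsto_nhds_unique (hc.tendsto.mono_left nhdsWithin_le_nhds)
    (tendsto_const_nhds.congr' (hb z).symm)
  linear_combination this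

/-- The Weierstrass function is injective up to sign and translation by the lattice. -/
theorem sub_mem_or_add_mem_of_weierstrassP_eq {u w : ℂ} (hu : u ∉ L.lattice) (hw : w ∉ L.lattice)
    (h : weierstrassP L w = weierstrassP L u) : w - u ∈ L.lattice ∨ w + u ∈ L.lattice := by
  by_contra! hwu
  obtain ⟨a, b, hab⟩ := exists_sq_mul_symmSum_eq L hu
  -- Evaluation at `w`, where the squared factor vanishes. Hence `b = -a ℘ u`, and one factor `℘ z -
  -- ℘ u` can be cancelled (`key`).
  have hb : a * weierstrassP L u + b = 0 := by
    have := hab w hw hwu.2 hwu.1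
    rw [h, sub_self] at this
    linear_combination -this
  have key (z : ℂ) (hz : z ∉ L.lattice) (h1 : z + u ∉ L.lattice) (h2 : z - u ∉ L.lattice)
      (h3 : weierstrassP L z ≠ weierstrassP L u) :
      (weierstrassP L z - weierstrassP L u) * symmSum L u z = a := by
    refine mul_left_cancel₀ (sub_ne_zero.2 h3) ?_
    linear_combination hab z hz h1 h2 + hb
  have hev (v : ℂ) : ∀ᶠ z in 𝓝[≠] v, z ∉ L.lattice ∧ z + u ∉ L.lattice ∧ z - u ∉ L.lattice ∧
      weierstrassP L z ≠ weierstrassP L u := by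
    have ht (c : ℂ) : Tendsto (fun z => z + c) (𝓝[≠] v) (𝓝[≠] (v + c)) := by
      refine tendsto_nhdsWithin_of_tendsto_nhds_of_eventually_within _
        (Continuous.tendsto (by fun_prop) v |>.mono_left nhdsWithin_le_nhds) ?_
      filter_upwards [self_mem_nhdsWithin] with z hz hz'
      exact hz (add_right_cancel hz')
    filter_upwards [eventually_notMem_lattice L v,
      (ht u).eventually (eventually_notMem_lattice L _),
      (ht (-u)).eventually (eventually_notMem_lattice L _),
      eventually_weierstrassP_ne L (weierstrassP L u) v] with z h1 h2 h3 h4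
    exact ⟨h1, h2, by rwa [sub_eq_add_neg], h4⟩
  -- As `z → w` the left side of `key` tends to `0`, since `symmSum` is regular at `w`.
  have ha : a = 0 := by
    have hc : ContinuousAt (fun z => (weierstrassP L z - weierstrassP L u) * symmSum L u z) w := by
      have := (L.analyticOnNhd_weierstrassP w hw).continuousAt
      have := (analyticAt_symmSum L hwu.2 hwu.1).continuousAt
      fun_prop
    have h1 := hc.tendsto.mono_left (nhdsWithin_le_nhds (s := {w}ᶜ))
    rw [h, sub_self, zero_mul] at h1
    refine tendsto_nhds_unique (tendsto_const_nhds.congr' ?_) h1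
    filter_upwards [hev w] with z hz
    exact (key z hz.1 hz.2.1 hz.2.2.1 hz.2.2.2).symm
  have hS : symmSum L u =ᶠ[𝓝[≠] u] fun _ => 0 := by
    filter_upwards [hev u] with z hz
    have := key z hz.1 hz.2.1 hz.2.2.1 hz.2.2.2
    rw [ha] at this
    exact (mul_eq_zero.1 this).resolve_left (sub_ne_zero.2 hz.2.2.2)
  -- The leading coefficient of `symmSum` at `u` is `1`, or `2` if `2u` is a period. In either case
  -- it contradicts the vanishing of `symmSum` near `u`.
  have := (hasDoublePole_symmSum L u u).unique
    ((AnalyticAt.hasDoublePole analyticAt_const).congr hS)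
  rw [sub_self, if_pos (zero_mem _)] at this
  split_ifs at this <;> norm_num at this

end Weierstrass

/-! ### The Weierstrass function as a map to the sphere -/

section Sphere

variable (L : PeriodPair)

open Classical in
/-- The Weierstrass function of a lattice as a map to the sphere. -/
def toSphere (z : ℂ) : OnePoint ℂ :=
  if z ∈ L.lattice then OnePoint.infty else ((weierstrassP L z : ℂ) : OnePoint ℂ)

theorem toSphere_of_mem {z : ℂ} (hz : z ∈ L.lattice) : toSphere L z = OnePoint.infty :=
  if_pos hz

theorem toSphere_of_notMem {z : ℂ} (hz : z ∉ L.lattice) :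
    toSphere L z = ((weierstrassP L z : ℂ) : OnePoint ℂ) :=
  if_neg hz

theorem toSphere_eq_infty_iff {z : ℂ} : toSphere L z = OnePoint.infty ↔ z ∈ L.lattice := by
  by_cases hz : z ∈ L.lattice
  · simp [toSphere_of_mem L hz, hz]
  · simp [toSphere_of_notMem L hz, hz]

theorem toSphere_eq_coe_iff {z x : ℂ} :
    toSphere L z = (x : OnePoint ℂ) ↔ z ∉ L.lattice ∧ weierstrassP L z = x := by
  by_cases hz : z ∈ L.lattice
  · simp [toSphere_of_mem L hz, hz]
  · simp [toSphere_of_notMem L hz, hz]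

theorem toSphere_neg (z : ℂ) : toSphere L (-z) = toSphere L z := by
  by_cases hz : z ∈ L.lattice
  · rw [toSphere_of_mem L hz, toSphere_of_mem L (neg_mem hz)]
  · rw [toSphere_of_notMem L hz, toSphere_of_notMem L (by simpa using hz), L.weierstrassP_neg]

theorem toSphere_add_coe (z : ℂ) {l : ℂ} (hl : l ∈ L.lattice) :
    toSphere L (z + l) = toSphere L z := by
  by_cases hz : z ∈ L.lattice
  · rw [toSphere_of_mem L hz, toSphere_of_mem L (add_mem hz hl)]
  · rw [toSphere_of_notMem L hz, toSphere_of_notMem L, L.weierstrassP_add_coe z ⟨l, hl⟩]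
    exact fun h => hz (by simpa using sub_mem h hl)

theorem toSphere_eq_iff {z w : ℂ} :
    toSphere L z = toSphere L w ↔ z - w ∈ L.lattice ∨ z + w ∈ L.lattice := by
  constructor
  · intro h
    by_cases hw : w ∈ L.lattice
    · rw [toSphere_of_mem L hw, toSphere_eq_infty_iff] at h
      exact Or.inl (sub_mem h hw)
    · rw [toSphere_of_notMem L hw, toSphere_eq_coe_iff] at h
      exact sub_mem_or_add_mem_of_weierstrassP_eq L hw h.1 h.2
  · rintro (h | h)
    · simpa using toSphere_add_coe L w h
    · have := toSphere_add_coe L (-w) h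
      rwa [toSphere_neg, neg_add_cancel_comm_assoc] at this

theorem toSphere_surjective : Function.Surjective (toSphere L) := by
  intro x
  induction x using OnePoint.rec with
  | infty => exact ⟨0, toSphere_of_mem L (zero_mem _)⟩
  | coe x =>
    obtain ⟨z, hz, h⟩ := exists_weierstrassP_eq L x
    exact ⟨z, (toSphere_eq_coe_iff L).2 ⟨hz, h⟩⟩

theorem countable_setOf_affine_mem_lattice {α : ℂ} (hα : α ≠ 0) (β : ℂ) :
    {z : ℂ | α * z + β ∈ L.lattice}.Countable :=
  (countable_lattice L).preimage fun _ _ h => mul_left_cancel₀ hα (add_right_cancel h)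

theorem countable_toSphere_fibre (x : OnePoint ℂ) : {z : ℂ | toSphere L z = x}.Countable := by
  obtain ⟨w, rfl⟩ := toSphere_surjective L x
  refine ((countable_setOf_affine_mem_lattice L one_ne_zero (-w)).union
    (countable_setOf_affine_mem_lattice L one_ne_zero w)).mono fun z hz => ?_
  simpa [sub_eq_add_neg] using (toSphere_eq_iff L).1 hz

theorem exists_notMem_of_countable {S : Set ℂ} (hS : S.Countable) : ∃ z, z ∉ S :=
  (Set.Countable.dense_compl ℝ hS).nonempty

end Sphere

/-! ### Möbius transformations of Weierstrass functions -/

section Mobius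

variable (L₁ L₂ : PeriodPair) (ε : GL (Fin 2) ℂ)

theorem smul_coe_of_ne {x : ℂ} (h : ε 1 0 * x + ε 1 1 ≠ 0) :
    ε • (x : OnePoint ℂ) =
      (((ε 0 0 * x + ε 0 1) / (ε 1 0 * x + ε 1 1) : ℂ) : OnePoint ℂ) := by
  rw [OnePoint.smul_some_eq_ite, if_neg h]

theorem smul_coe_eq_coe_iff {x y : ℂ} : ε • (x : OnePoint ℂ) = (y : OnePoint ℂ) ↔
    ε 1 0 * x + ε 1 1 ≠ 0 ∧ (ε 0 0 * x + ε 0 1) / (ε 1 0 * x + ε 1 1) = y := by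
  rw [OnePoint.smul_some_eq_ite]
  split_ifs with h <;> simp [h]

theorem smul_coe_eq_infty_iff {x : ℂ} : ε • (x : OnePoint ℂ) = OnePoint.infty ↔
    ε 1 0 * x + ε 1 1 = 0 := by
  rw [OnePoint.smul_some_eq_ite]
  split_ifs with h <;> simp [h]

variable {L₁ L₂ ε}

/-- The identity theorem for Möbius transforms of Weierstrass functions. -/
theorem smul_toSphere_eq_of_frequently {α β z₀ : ℂ} (hα : α ≠ 0) (h1 : z₀ ∉ L₁.lattice)
    (h2 : α * z₀ + β ∉ L₂.lattice) (h3 : ε • toSphere L₁ z₀ ≠ OnePoint.infty)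
    (h : ∃ᶠ z in 𝓝[≠] z₀, ε • toSphere L₁ z = toSphere L₂ (α * z + β)) :
    ∃ S : Set ℂ, S.Countable ∧ ∀ z ∉ S, ε • toSphere L₁ z = toSphere L₂ (α * z + β) := by
  -- Off `S` both sides are finite and analytic, and the complement of `S` is connected because `S`
  -- is countable.
  set S : Set ℂ := L₁.lattice ∪ {z | α * z + β ∈ L₂.lattice} ∪
    {z | toSphere L₁ z = ε⁻¹ • OnePoint.infty} with hSdef
  have hS : S.Countable := ((countable_lattice L₁).union
    (countable_setOf_affine_mem_lattice L₂ hα β)).union (countable_toSphere_fibre L₁ _)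
  have hmem {z : ℂ} (hz : z ∉ S) : z ∉ L₁.lattice ∧ α * z + β ∉ L₂.lattice ∧
      ε 1 0 * weierstrassP L₁ z + ε 1 1 ≠ 0 := by
    simp only [hSdef, Set.mem_union, not_or, SetLike.mem_coe, Set.mem_ofPred_eq] at hz
    refine ⟨hz.1.1, hz.1.2, fun h0 => hz.2 ?_⟩
    rw [eq_inv_smul_iff, toSphere_of_notMem L₁ hz.1.1]
    exact (smul_coe_eq_infty_iff ε).2 h0
  have hz₀ : z₀ ∉ S := by
    simp only [hSdef, Set.mem_union, not_or, SetLike.mem_coe, Set.mem_ofPred_eq]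
    exact ⟨⟨h1, h2⟩, fun h0 => h3 (by rw [h0, smul_inv_smul])⟩
  have hF : AnalyticOnNhd ℂ (fun z => (ε 0 0 * weierstrassP L₁ z + ε 0 1) /
      (ε 1 0 * weierstrassP L₁ z + ε 1 1)) Sᶜ := by
    intro z hz
    have := L₁.analyticOnNhd_weierstrassP z (hmem hz).1
    exact ((analyticAt_const.mul this).add analyticAt_const).div
      ((analyticAt_const.mul this).add analyticAt_const) (hmem hz).2.2
  have hG : AnalyticOnNhd ℂ (fun z => weierstrassP L₂ (α * z + β)) Sᶜ := fun z hz =>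
    AnalyticAt.fun_comp (L₂.analyticOnNhd_weierstrassP _ (hmem hz).2.1) (by fun_prop)
  have hval {z : ℂ} (hz : z ∉ L₁.lattice ∧ α * z + β ∉ L₂.lattice ∧
      ε 1 0 * weierstrassP L₁ z + ε 1 1 ≠ 0) : ε • toSphere L₁ z = toSphere L₂ (α * z + β) ↔
      (ε 0 0 * weierstrassP L₁ z + ε 0 1) / (ε 1 0 * weierstrassP L₁ z + ε 1 1) =
        weierstrassP L₂ (α * z + β) := by
    rw [toSphere_of_notMem L₁ hz.1, toSphere_of_notMem L₂ hz.2.1, smul_coe_of_ne ε hz.2.2,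
      OnePoint.coe_eq_coe]
  have hev : ∀ᶠ z in 𝓝[≠] z₀, z ∉ L₁.lattice ∧ α * z + β ∉ L₂.lattice ∧
      ε 1 0 * weierstrassP L₁ z + ε 1 1 ≠ 0 := by
    refine nhdsWithin_le_nhds ?_
    have hc := (L₁.analyticOnNhd_weierstrassP z₀ h1).continuousAt
    have hc' : ContinuousAt (fun z => ε 1 0 * weierstrassP L₁ z + ε 1 1) z₀ := by fun_prop
    have hc'' : ContinuousAt (fun z => α * z + β) z₀ := by fun_prop
    filter_upwards [L₁.isClosed_lattice.isOpen_compl.mem_nhds h1,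
      hc''.eventually (L₂.isClosed_lattice.isOpen_compl.mem_nhds h2),
      hc'.eventually_ne (hmem hz₀).2.2] with z a b c
    exact ⟨a, b, c⟩
  have := hF.eqOn_of_preconnected_of_frequently_eq hG (isPreconnected_compl_of_countable hS) hz₀
    ((h.and_eventually hev).mono fun z hz => (hval hz.2).1 hz.1)
  exact ⟨S, hS, fun z hz => (hval (hmem hz)).2 (this hz)⟩

/-- Since `ε` is injective, both sides have the same periods. -/
theorem mem_lattice_iff_of_smul_toSphere_eq {α β : ℂ} (hα : α ≠ 0) {S : Set ℂ}
    (hS : S.Countable) (h : ∀ z ∉ S, ε • toSphere L₁ z = toSphere L₂ (α * z + β)) (ω : ℂ) :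
    ω ∈ L₁.lattice ↔ α * ω ∈ L₂.lattice := by
  have hS' : {z : ℂ | z + ω ∈ S}.Countable := hS.preimage (add_left_injective ω)
  have h2α : 2 * α ≠ 0 := mul_ne_zero two_ne_zero hα
  -- Equal values of `℘` at `z` and `z + ω` leave a choice of sign. The last two sets are avoided to
  -- exclude the reflected alternative in either lattice.
  obtain ⟨z, hz⟩ := exists_notMem_of_countable (((hS.union hS').union
    (countable_setOf_affine_mem_lattice L₁ (two_ne_zero (α := ℂ)) ω)).union
    (countable_setOf_affine_mem_lattice L₂ h2α (2 * β + α * ω)))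
  simp only [Set.mem_union, not_or, Set.mem_ofPred_eq] at hz
  obtain ⟨⟨⟨hz1, hz2⟩, hz3⟩, hz4⟩ := hz
  have e1 := h z hz1
  have e2 := h _ hz2
  constructor
  · intro hω
    rw [toSphere_add_coe L₁ z hω, e1, eq_comm, toSphere_eq_iff] at e2
    rcases e2 with e2 | e2
    · convert e2 using 1
      ring
    · exact absurd (by convert e2 using 1; ring) hz4
  · intro hω
    rw [mul_add, add_right_comm, toSphere_add_coe L₂ _ hω, ← e1] at e2
    rcases (toSphere_eq_iff L₁).1 (MulAction.injective ε e2) with e2 | e2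
    · simpa using e2
    · exact absurd (by convert e2 using 1; ring) hz3

end Mobius

/-! ### The differential equation -/

/-- Subtracting the equations and dividing by `F' + G'`, nonzero at `t₀`, gives a linear equation
`D' = k D` for `D = F - G` with `D t₀ = 0`. -/
theorem eventuallyEq_of_deriv_sq_eq {F G : ℂ → ℂ} {A B C t₀ : ℂ} (hF : AnalyticAt ℂ F t₀)
    (hG : AnalyticAt ℂ G t₀) (h0 : F t₀ = G t₀) (h1 : deriv F t₀ = deriv G t₀)
    (hne : deriv F t₀ ≠ 0) (eF : ∀ᶠ t in 𝓝 t₀, deriv F t ^ 2 = A * F t ^ 3 + B * F t + C)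
    (eG : ∀ᶠ t in 𝓝 t₀, deriv G t ^ 2 = A * G t ^ 3 + B * G t + C) : F =ᶠ[𝓝 t₀] G := by
  set D : ℂ → ℂ := fun t => F t - G t with hD
  have hDa : AnalyticAt ℂ D t₀ := hF.sub hG
  have hs : AnalyticAt ℂ (fun t => deriv F t + deriv G t) t₀ := hF.deriv.add hG.deriv
  have hs0 : deriv F t₀ + deriv G t₀ ≠ 0 := by
    rw [← h1, ← two_mul]
    exact mul_ne_zero two_ne_zero hne
  set k : ℂ → ℂ := fun t => (A * (F t ^ 2 + F t * G t + G t ^ 2) + B) /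
    (deriv F t + deriv G t) with hk
  have hka : AnalyticAt ℂ k t₀ := AnalyticAt.div (by fun_prop) hs hs0
  have hode : deriv D =ᶠ[𝓝 t₀] D * k := by
    filter_upwards [eF, eG, hF.eventually_analyticAt, hG.eventually_analyticAt,
      hs.continuousAt.eventually_ne hs0] with t a b c d e
    have : deriv D t = deriv F t - deriv G t :=
      deriv_fun_sub c.differentiableAt d.differentiableAt
    rw [Pi.mul_apply, this, hk, mul_div_assoc', eq_div_iff e]
    simp only [hD]
    linear_combination a - b
  have hord := hDa.analyticOrderAt_deriv_add_one
  have hD0 : (fun t => D t - D t₀) = D := by simp [hD, h0]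
  -- Now `ord D + ord k + 1 = ord D`, which is possible only for infinite order.
  rw [hD0, analyticOrderAt_congr hode, analyticOrderAt_mul hDa hka] at hord
  have htop : analyticOrderAt D t₀ = ⊤ := by
    by_contra hne
    obtain ⟨m, hm⟩ := ENat.ne_top_iff_exists.1 hne
    have hle : analyticOrderAt D t₀ + 1 ≤ analyticOrderAt D t₀ := by
      conv_rhs => rw [← hord]
      gcongr
      exact le_self_add
    rw [← hm] at hle
    norm_cast at hle
    omega
  filter_upwards [analyticOrderAt_eq_top.1 htop] with t ht
  exact sub_eq_zero.1 ht

section Cubic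

variable (L : PeriodPair)

/-- The image in the sphere of the points of order dividing two. -/
def branchSet : Set (OnePoint ℂ) := {x | ∃ h : ℂ, 2 * h ∈ L.lattice ∧ toSphere L h = x}

theorem cubic_eq_zero_of_mem_branchSet {x : ℂ} (hx : (x : OnePoint ℂ) ∈ branchSet L) :
    4 * x ^ 3 - L.g₂ * x - L.g₃ = 0 := by
  obtain ⟨h, h2, hx⟩ := hx
  obtain ⟨hL, rfl⟩ := (toSphere_eq_coe_iff L).1 hx
  -- `℘'` is odd and periodic, so `℘' h = -℘' h` at a half period.
  have h0 : derivWeierstrassP L h = 0 := by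
    have h1 := L.derivWeierstrassP_add_coe (-h) ⟨2 * h, h2⟩
    rw [L.derivWeierstrassP_neg, show -h + 2 * h = h by ring] at h1
    exact CharZero.eq_neg_self_iff.1 h1
  rw [← L.derivWeierstrassP_sq h hL, h0, zero_pow two_ne_zero]

theorem infty_mem_branchSet : OnePoint.infty ∈ branchSet L :=
  ⟨0, by simp, toSphere_of_mem L (zero_mem _)⟩

theorem exists_branchSet_triple : ∃ e₁ e₂ e₃ : ℂ, e₁ ≠ e₂ ∧ e₁ ≠ e₃ ∧ e₂ ≠ e₃ ∧
    (e₁ : OnePoint ℂ) ∈ branchSet L ∧ (e₂ : OnePoint ℂ) ∈ branchSet L ∧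
    (e₃ : OnePoint ℂ) ∈ branchSet L := by
  have hmem (p q : ℚ) (h : ¬ (p.den = 1 ∧ q.den = 1)) : p * L.ω₁ + q * L.ω₂ ∉ L.lattice :=
    fun h' => h (L.mul_ω₁_add_mul_ω₂_mem_lattice.1 h')
  have m1 : L.ω₁ / 2 ∉ L.lattice := L.ω₁_div_two_notMem_lattice
  have m2 : L.ω₂ / 2 ∉ L.lattice := L.ω₂_div_two_notMem_lattice
  have m3 : L.ω₁ / 2 + L.ω₂ / 2 ∉ L.lattice := by
    have e : L.ω₁ / 2 + L.ω₂ / 2 = ((1 / 2 : ℚ) : ℂ) * L.ω₁ + ((1 / 2 : ℚ) : ℂ) * L.ω₂ := by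
      push_cast
      ring
    rw [e]
    exact hmem _ _ (by norm_num)
  have m4 : L.ω₁ / 2 - L.ω₂ / 2 ∉ L.lattice := fun h => m3 (by
    convert add_mem h L.ω₂_mem_lattice using 1
    ring)
  have i1 := L.ω₁_mem_lattice
  have i2 := L.ω₂_mem_lattice
  refine ⟨weierstrassP L (L.ω₁ / 2), weierstrassP L (L.ω₂ / 2),
    weierstrassP L (L.ω₁ / 2 + L.ω₂ / 2), fun h => ?_, fun h => ?_, fun h => ?_,
    ⟨_, ?_, toSphere_of_notMem L m1⟩, ⟨_, ?_, toSphere_of_notMem L m2⟩,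
    ⟨_, ?_, toSphere_of_notMem L m3⟩⟩
  · rcases sub_mem_or_add_mem_of_weierstrassP_eq L m2 m1 h with h | h
    · exact m4 h
    · exact m3 h
  · rcases sub_mem_or_add_mem_of_weierstrassP_eq L m3 m1 h with h | h
    · exact m2 (by simpa using h)
    · exact m2 (by convert sub_mem h i1 using 1; ring)
  · rcases sub_mem_or_add_mem_of_weierstrassP_eq L m3 m2 h with h | h
    · exact m1 (by simpa using h)
    · exact m1 (by convert sub_mem h i2 using 1; ring)
  · simpa [mul_div_cancel₀] using i1
  · simpa [mul_div_cancel₀] using i2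
  · convert add_mem i1 i2 using 1
    ring

theorem quadratic_eq_zero_of_three_roots {a b c e₁ e₂ e₃ : ℂ} (h12 : e₁ ≠ e₂) (h13 : e₁ ≠ e₃)
    (h23 : e₂ ≠ e₃) (h1 : a * e₁ ^ 2 + b * e₁ + c = 0) (h2 : a * e₂ ^ 2 + b * e₂ + c = 0)
    (h3 : a * e₃ ^ 2 + b * e₃ + c = 0) : a = 0 ∧ b = 0 ∧ c = 0 := by
  have i12 : a * (e₁ + e₂) + b = 0 :=
    mul_left_cancel₀ (sub_ne_zero.2 h12) (by linear_combination h1 - h2)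
  have i13 : a * (e₁ + e₃) + b = 0 :=
    mul_left_cancel₀ (sub_ne_zero.2 h13) (by linear_combination h1 - h3)
  have ha : a = 0 := mul_left_cancel₀ (sub_ne_zero.2 h23) (by linear_combination i12 - i13)
  subst ha
  have hb : b = 0 := by linear_combination i12
  subst hb
  exact ⟨rfl, rfl, by linear_combination h1⟩

/-- A polynomial function of degree at most three is determined up to a factor by three roots. -/
theorem cubic_eq_mul_of_three_roots {a b c d e₁ e₂ e₃ : ℂ} (h12 : e₁ ≠ e₂) (h13 : e₁ ≠ e₃)
    (h23 : e₂ ≠ e₃) (h1 : a * e₁ ^ 3 + b * e₁ ^ 2 + c * e₁ + d = 0)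
    (h2 : a * e₂ ^ 3 + b * e₂ ^ 2 + c * e₂ + d = 0)
    (h3 : a * e₃ ^ 3 + b * e₃ ^ 2 + c * e₃ + d = 0) (x : ℂ) :
    a * x ^ 3 + b * x ^ 2 + c * x + d = a * ((x - e₁) * (x - e₂) * (x - e₃)) := by
  obtain ⟨i, j, k⟩ := quadratic_eq_zero_of_three_roots (a := b + a * (e₁ + e₂ + e₃))
    (b := c - a * (e₁ * e₂ + e₁ * e₃ + e₂ * e₃)) (c := d + a * (e₁ * e₂ * e₃)) h12 h13 h23
    (by linear_combination h1) (by linear_combination h2) (by linear_combination h3)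
  linear_combination x ^ 2 * i + x * j + k

end Cubic

/-- A Möbius transformation that maps branch points to branch points lifts to an affine map. -/
theorem exists_affine_lift {L₁ L₂ : PeriodPair} {ε : GL (Fin 2) ℂ}
    (hε : ∀ x ∈ branchSet L₁, ε • x ∈ branchSet L₂) :
    ∃ α β : ℂ, α ≠ 0 ∧ ∃ S : Set ℂ, S.Countable ∧
      ∀ z ∉ S, ε • toSphere L₁ z = toSphere L₂ (α * z + β) := by
  obtain ⟨e₁, e₂, e₃, h12, h13, h23, b1, b2, b3⟩ := exists_branchSet_triple L₁
  set a := ε 0 0 with ha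
  set b := ε 0 1 with hb
  set c := ε 1 0 with hc
  set d := ε 1 1 with hd
  have hdet : a * d - b * c ≠ 0 := by
    have := ε.det_ne_zero
    rwa [Matrix.det_fin_two] at this
  have hclear (u v : ℂ) (hv : v ≠ 0) : v ^ 4 * (4 * (u / v) ^ 3 - L₂.g₂ * (u / v) - L₂.g₃) =
      v * (4 * u ^ 3 - L₂.g₂ * u * v ^ 2 - L₂.g₃ * v ^ 3) := by
    field_simp
  -- The second cubic, pulled back along `ε`, is homogenized to degree four; the extra factor `c * e
  -- + d` accounts for the branch value `∞`.
  have hbranch (e : ℂ) (he : (e : OnePoint ℂ) ∈ branchSet L₁) :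
      (c * e + d) * (4 * (a * e + b) ^ 3 - L₂.g₂ * (a * e + b) * (c * e + d) ^ 2 -
        L₂.g₃ * (c * e + d) ^ 3) = 0 := by
    by_cases h0 : c * e + d = 0
    · rw [h0, zero_mul]
    · have := hε _ he
      rw [smul_coe_of_ne ε h0] at this
      have := cubic_eq_zero_of_mem_branchSet L₂ this
      simp only [← ha, ← hb, ← hc, ← hd] at this
      rw [← hclear _ _ h0, this, mul_zero]
  -- This is the coefficient of `x ^ 4`; it vanishes because `∞` is a branch value too. The pullback
  -- is then a cubic with roots `e₁, e₂, e₃`, and `k` is its leading coefficient.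
  have hlead : c * (4 * a ^ 3 - L₂.g₂ * a * c ^ 2 - L₂.g₃ * c ^ 3) = 0 := by
    by_cases h0 : c = 0
    · rw [h0, zero_mul]
    · have := hε _ (infty_mem_branchSet L₁)
      rw [OnePoint.smul_infty_eq_ite, if_neg h0] at this
      have := cubic_eq_zero_of_mem_branchSet L₂ this
      simp only [← ha, ← hc] at this
      rw [← hclear _ _ h0, this, mul_zero]
  obtain ⟨k, hk⟩ : ∃ k : ℂ, ∀ x, (c * x + d) * (4 * (a * x + b) ^ 3 -
      L₂.g₂ * (a * x + b) * (c * x + d) ^ 2 - L₂.g₃ * (c * x + d) ^ 3) =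
      k * ((x - e₁) * (x - e₂) * (x - e₃)) := by
    set g := L₂.g₂
    set h := L₂.g₃
    refine ⟨4 * a ^ 3 * d + 12 * a ^ 2 * b * c - g * (3 * a * c ^ 2 * d + b * c ^ 3) -
      4 * h * c ^ 3 * d, fun x => ?_⟩
    have key (x : ℂ) : (c * x + d) * (4 * (a * x + b) ^ 3 -
      g * (a * x + b) * (c * x + d) ^ 2 - h * (c * x + d) ^ 3) =
      (4 * a ^ 3 * d + 12 * a ^ 2 * b * c - g * (3 * a * c ^ 2 * d + b * c ^ 3) -
        4 * h * c ^ 3 * d) * x ^ 3 +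
      (12 * a ^ 2 * b * d + 12 * a * b ^ 2 * c - g * (3 * a * c * d ^ 2 + 3 * b * c ^ 2 * d) -
        6 * h * c ^ 2 * d ^ 2) * x ^ 2 +
      (12 * a * b ^ 2 * d + 4 * b ^ 3 * c - g * (a * d ^ 3 + 3 * b * c * d ^ 2) -
        4 * h * c * d ^ 3) * x + (4 * b ^ 3 * d - g * b * d ^ 3 - h * d ^ 4) := by
      linear_combination x ^ 4 * hlead
    rw [key]
    exact cubic_eq_mul_of_three_roots h12 h13 h23 (by rw [← key, hbranch _ b1])
      (by rw [← key, hbranch _ b2]) (by rw [← key, hbranch _ b3]) x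
  have hQ₁ (x : ℂ) : 4 * x ^ 3 - L₁.g₂ * x - L₁.g₃ = 4 * ((x - e₁) * (x - e₂) * (x - e₃)) := by
    have i1 := cubic_eq_zero_of_mem_branchSet L₁ b1
    have i2 := cubic_eq_zero_of_mem_branchSet L₁ b2
    have i3 := cubic_eq_zero_of_mem_branchSet L₁ b3
    have := cubic_eq_mul_of_three_roots (a := 4) (b := 0) (c := -L₁.g₂) (d := -L₁.g₃) h12 h13 h23
      (by linear_combination i1) (by linear_combination i2) (by linear_combination i3) x
    linear_combination this
  -- The base point is chosen so that `ε ∘ ℘` is finite there and not a root of the second cubic;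
  -- its derivative is then nonzero.
  obtain ⟨z₀, hz₀⟩ : ∃ z₀, z₀ ∉ ((L₁.lattice : Set ℂ) ∪
      {z | toSphere L₁ z = ε⁻¹ • OnePoint.infty}) ∪ ⋃ x ∈ {y : ℂ | 4 * y ^ 3 - L₂.g₂ * y - L₂.g₃ = 0},
        {z | toSphere L₁ z = ε⁻¹ • (x : OnePoint ℂ)} := by
    refine exists_notMem_of_countable (((countable_lattice L₁).union
      (countable_toSphere_fibre L₁ _)).union
      (Set.Countable.biUnion ?_ fun x _ => countable_toSphere_fibre L₁ _))
    obtain ⟨e₁, e₂, e₃, h12, h13, h23, b1, b2, b3⟩ := exists_branchSet_triple L₂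
    refine (Set.toFinite {e₁, e₂, e₃}).countable.mono fun y hy => ?_
    have hy : 4 * y ^ 3 - L₂.g₂ * y - L₂.g₃ = 0 := hy
    have i1 := cubic_eq_zero_of_mem_branchSet L₂ b1
    have i2 := cubic_eq_zero_of_mem_branchSet L₂ b2
    have i3 := cubic_eq_zero_of_mem_branchSet L₂ b3
    have := cubic_eq_mul_of_three_roots (a := 4) (b := 0) (c := -L₂.g₂) (d := -L₂.g₃) h12 h13 h23
      (by linear_combination i1) (by linear_combination i2) (by linear_combination i3) y
    have : (y - e₁) * (y - e₂) * (y - e₃) = 0 := by linear_combination hy / 4 - this / 4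
    simpa [sub_eq_zero, or_assoc] using this
  simp only [Set.mem_union, not_or, SetLike.mem_coe, Set.mem_ofPred_eq, Set.mem_iUnion,
    not_exists, eq_inv_smul_iff] at hz₀
  obtain ⟨⟨hzL, hzi⟩, hzb⟩ := hz₀
  rw [toSphere_of_notMem L₁ hzL] at hzi hzb
  set x := weierstrassP L₁ z₀ with hx
  have hcx : c * x + d ≠ 0 := fun h => hzi ((smul_coe_eq_infty_iff ε).2 h)
  set y := (a * x + b) / (c * x + d) with hy
  have hQy : 4 * y ^ 3 - L₂.g₂ * y - L₂.g₃ ≠ 0 := fun h => hzb y h (smul_coe_of_ne ε hcx)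
  have hQk (x : ℂ) (hcx : c * x + d ≠ 0) : (c * x + d) ^ 4 *
      (4 * ((a * x + b) / (c * x + d)) ^ 3 - L₂.g₂ * ((a * x + b) / (c * x + d)) - L₂.g₃) =
      k / 4 * (4 * x ^ 3 - L₁.g₂ * x - L₁.g₃) := by
    rw [hQ₁, show k / 4 * (4 * ((x - e₁) * (x - e₂) * (x - e₃))) =
      k * ((x - e₁) * (x - e₂) * (x - e₃)) by ring, ← hk,
      hclear _ _ hcx]
  have hk0 : k ≠ 0 := by
    rintro rfl
    have := hQk x hcx
    rw [zero_div, zero_mul] at this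
    exact (mul_ne_zero (pow_ne_zero 4 hcx) hQy) this
  -- For `F = ε ∘ ℘` one has `F' = det ε · ℘' / (c ℘ + d)²`, and by `hQk` its square is `4 (det ε)²
  -- / k` times the second cubic at `F`.
  obtain ⟨α, hα⟩ := IsAlgClosed.exists_pow_nat_eq (4 * (a * d - b * c) ^ 2 / k) (n := 2) two_pos
  have hα0 : α ≠ 0 := by
    rintro rfl
    have : 4 * (a * d - b * c) ^ 2 / k ≠ 0 :=
      div_ne_zero (mul_ne_zero (by norm_num) (pow_ne_zero 2 hdet)) hk0
    exact this (by rw [← hα]; simp)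
  set F : ℂ → ℂ := fun z => (a * weierstrassP L₁ z + b) / (c * weierstrassP L₁ z + d) with hFdef
  have hd₁ (z : ℂ) (hz : z ∉ L₁.lattice) :
      HasDerivAt (weierstrassP L₁) (derivWeierstrassP L₁ z) z := by
    have := (L₁.analyticOnNhd_weierstrassP z hz).differentiableAt.hasDerivAt
    rwa [L₁.deriv_weierstrassP] at this
  have hd₂ (z : ℂ) (hz : z ∉ L₂.lattice) :
      HasDerivAt (weierstrassP L₂) (derivWeierstrassP L₂ z) z := by
    have := (L₂.analyticOnNhd_weierstrassP z hz).differentiableAt.hasDerivAt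
    rwa [L₂.deriv_weierstrassP] at this
  have hF' (z : ℂ) (hz : z ∉ L₁.lattice) (h0 : c * weierstrassP L₁ z + d ≠ 0) :
      deriv F z ^ 2 = α ^ 2 * (4 * F z ^ 3 - L₂.g₂ * F z - L₂.g₃) := by
    have h1 := (((hd₁ z hz).const_mul a).add_const b).fun_div
      (((hd₁ z hz).const_mul c).add_const d) h0
    have h2 := hQk _ h0
    rw [← L₁.derivWeierstrassP_sq z hz] at h2
    rw [h1.deriv, hα]
    simp only [hFdef]
    rw [← mul_right_inj' (pow_ne_zero 4 h0)]
    rw [mul_left_comm (_ ^ 4) (4 * (a * d - b * c) ^ 2 / k), h2]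
    field_simp
    ring
  have hFa : AnalyticAt ℂ F z₀ := by
    have := L₁.analyticOnNhd_weierstrassP z₀ hzL
    exact ((analyticAt_const.mul this).add analyticAt_const).div
      ((analyticAt_const.mul this).add analyticAt_const) hcx
  have hFev : ∀ᶠ z in 𝓝 z₀, z ∉ L₁.lattice ∧ c * weierstrassP L₁ z + d ≠ 0 := by
    have := (L₁.analyticOnNhd_weierstrassP z₀ hzL).continuousAt
    have hc' : ContinuousAt (fun z => c * weierstrassP L₁ z + d) z₀ := by fun_prop
    filter_upwards [L₁.isClosed_lattice.isOpen_compl.mem_nhds hzL,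
      hc'.eventually_ne hcx] with z a b
    exact ⟨a, b⟩
  have hFz : deriv F z₀ ^ 2 = α ^ 2 * (4 * y ^ 3 - L₂.g₂ * y - L₂.g₃) := hF' z₀ hzL hcx
  have hFne : deriv F z₀ ≠ 0 := by
    intro h0
    rw [h0, zero_pow two_ne_zero] at hFz
    exact mul_ne_zero (pow_ne_zero 2 hα0) hQy hFz.symm
  -- The equation fixes the derivative up to sign, and replacing `w` by `-w` corrects the sign.
  have hlift : ∃ w ∉ L₂.lattice, weierstrassP L₂ w = y ∧
      α * derivWeierstrassP L₂ w = deriv F z₀ := by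
    obtain ⟨w, hw, hwy⟩ := exists_weierstrassP_eq L₂ y
    have : (deriv F z₀) ^ 2 = (α * derivWeierstrassP L₂ w) ^ 2 := by
      rw [hFz, mul_pow, L₂.derivWeierstrassP_sq w hw, hwy]
    rcases sq_eq_sq_iff_eq_or_eq_neg.1 this with h | h
    · exact ⟨w, hw, hwy, h.symm⟩
    · exact ⟨-w, by simpa using hw, by rw [L₂.weierstrassP_neg, hwy],
        by rw [L₂.derivWeierstrassP_neg, h]; ring⟩
  obtain ⟨w, hw, hwy, hw'⟩ := hlift
  set G : ℂ → ℂ := fun z => weierstrassP L₂ (α * z + (w - α * z₀)) with hGdef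
  have hz₀w : α * z₀ + (w - α * z₀) = w := by ring
  have hG' (z : ℂ) (hz : α * z + (w - α * z₀) ∉ L₂.lattice) :
      HasDerivAt G (α * derivWeierstrassP L₂ (α * z + (w - α * z₀))) z := by
    have h1 : HasDerivAt (fun z => α * z + (w - α * z₀)) α z := by
      simpa using ((hasDerivAt_id z).const_mul α).add_const (w - α * z₀)
    exact ((hd₂ _ hz).comp z h1).congr_deriv (mul_comm _ _)
  have hGev : ∀ᶠ z in 𝓝 z₀, α * z + (w - α * z₀) ∉ L₂.lattice := by
    have hc' : ContinuousAt (fun z => α * z + (w - α * z₀)) z₀ := by fun_prop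
    exact hc'.eventually (L₂.isClosed_lattice.isOpen_compl.mem_nhds (by simpa using hw))
  have hGa : AnalyticAt ℂ G z₀ :=
    AnalyticAt.fun_comp (L₂.analyticOnNhd_weierstrassP _ (by simpa using hw)) (by fun_prop)
  have hFG : F =ᶠ[𝓝 z₀] G := by
    refine eventuallyEq_of_deriv_sq_eq (A := α ^ 2 * 4) (B := -(α ^ 2 * L₂.g₂))
      (C := -(α ^ 2 * L₂.g₃)) hFa hGa ?_ ?_ hFne ?_ ?_
    · simp only [hGdef, hz₀w, hwy]
      rfl
    · rw [(hG' z₀ (by rwa [hz₀w])).deriv, hz₀w, hw']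
    · filter_upwards [hFev] with z hz
      rw [hF' z hz.1 hz.2]
      ring
    · filter_upwards [hGev] with z hz
      rw [(hG' z hz).deriv, mul_pow, L₂.derivWeierstrassP_sq _ hz]
      ring
  refine ⟨α, w - α * z₀, hα0, smul_toSphere_eq_of_frequently hα0 hzL (by rwa [hz₀w]) ?_
    (Eventually.frequently (nhdsWithin_le_nhds ?_))⟩
  · rw [toSphere_of_notMem L₁ hzL]
    exact hzi
  · filter_upwards [hFG, hFev, hGev] with z h1 h2 h3
    rw [toSphere_of_notMem L₁ h2.1, toSphere_of_notMem L₂ h3, smul_coe_of_ne ε h2.2]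
    exact congrArg _ h1

open Polynomial

/-! ### Rational functions and their fibres -/

theorem denom_eval_ne_zero_of_num_eval_eq_zero {f : RatFunc ℂ} {x : ℂ} (h : f.num.eval x = 0) :
    f.denom.eval x ≠ 0 := by
  intro h'
  obtain ⟨a, b, hab⟩ := f.isCoprime_num_denom
  have := congrArg (Polynomial.eval x) hab
  simp [h, h'] at this

theorem sphereMap_coe_of_ne {f : RatFunc ℂ} {x : ℂ} (h : f.denom.eval x ≠ 0) :
    sphereMap f (x : OnePoint ℂ) = ((f.num.eval x / f.denom.eval x : ℂ) : OnePoint ℂ) :=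
  if_neg h

theorem sphereMap_coe_eq_infty {f : RatFunc ℂ} {x : ℂ} (h : f.denom.eval x = 0) :
    sphereMap f (x : OnePoint ℂ) = OnePoint.infty :=
  if_pos h

theorem sphereMap_infty_of_lt {f : RatFunc ℂ} (h : f.denom.natDegree < f.num.natDegree) :
    sphereMap f OnePoint.infty = OnePoint.infty :=
  if_pos h

theorem sphereMap_injective : Function.Injective sphereMap := by
  intro f g h
  have hpoly : f.num * g.denom = g.num * f.denom := by
    refine Polynomial.eq_of_infinite_eval_eq _ _ (Set.infinite_of_finite_compl ?_)
    refine ((f.denom.rootSet_finite ℂ).union (g.denom.rootSet_finite ℂ)).subset fun x hx => ?_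
    by_contra hx'
    simp only [Set.mem_union, mem_rootSet, f.denom_ne_zero, g.denom_ne_zero, ne_eq,
      not_false_eq_true, true_and, not_or, coe_aeval_eq_eval] at hx'
    have := congrFun h (x : OnePoint ℂ)
    rw [sphereMap_coe_of_ne hx'.1, sphereMap_coe_of_ne hx'.2, OnePoint.coe_eq_coe,
      div_eq_div_iff hx'.1 hx'.2] at this
    exact hx (by simpa using this)
  rw [RatFunc.num_mul_eq_mul_denom_iff g.denom_ne_zero, RatFunc.num_div_denom] at hpoly
  exact hpoly

/-- All but finitely many fibres of a rational function have as many points as its degree. -/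
theorem exists_finite_ncard_fibre_eq (f : RatFunc ℂ) :
    ∃ B : Set (OnePoint ℂ), B.Finite ∧ ∀ y ∉ B, (sphereMap f ⁻¹' {y}).ncard = ratDegree f := by
  classical
  set p := f.num with hp
  set q := f.denom with hq
  -- Excluded are `∞`, the value at `∞` when finite, and the values at the zeros of the Wronskian.
  -- For other `c` the polynomial `p - c q` has full degree and simple roots.
  refine ⟨{OnePoint.infty, ((p.coeff q.natDegree : ℂ) : OnePoint ℂ)} ∪
    (fun x : ℂ => ((p.eval x / q.eval x : ℂ) : OnePoint ℂ)) '' ((wronskian p q).roots.toFinset),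
    (Set.toFinite _).union (Set.toFinite _), fun y hy => ?_⟩
  simp only [Set.mem_union, Set.mem_insert_iff, Set.mem_singleton_iff, not_or] at hy
  obtain ⟨⟨hy0, hy1⟩, hy2⟩ := hy
  induction y using OnePoint.rec with
  | infty => exact absurd rfl hy0
  | coe c =>
    rw [OnePoint.coe_eq_coe] at hy1
    set r := p - Polynomial.C c * q with hr
    have hqm : q.coeff q.natDegree = 1 := f.monic_denom
    have hdeg : r.natDegree = ratDegree f := by
      refine Polynomial.natDegree_eq_of_le_of_coeff_ne_zero ?_ ?_
      · refine (natDegree_sub_le _ _).trans (max_le_max le_rfl (natDegree_C_mul_le _ _))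
      · rcases lt_or_ge q.natDegree p.natDegree with h | h
        · rw [ratDegree, max_eq_left h.le, hr, coeff_sub, coeff_C_mul,
            coeff_eq_zero_of_natDegree_lt h, mul_zero, sub_zero]
          exact leadingCoeff_ne_zero.2 (ne_zero_of_natDegree_gt h)
        · rw [ratDegree, max_eq_right h, hr, coeff_sub, coeff_C_mul, hqm, mul_one]
          exact sub_ne_zero.2 (Ne.symm hy1)
    have hr0 : r ≠ 0 := by
      intro h0
      have : p = Polynomial.C c * q := sub_eq_zero.1 h0
      exact hy1 (by rw [this, coeff_C_mul, hqm, mul_one])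
    have hroot {x : ℂ} (hx : r.IsRoot x) : q.eval x ≠ 0 ∧ p.eval x / q.eval x = c := by
      have h1 : p.eval x = c * q.eval x := by
        have : r.eval x = 0 := hx
        rw [hr, eval_sub, eval_mul, eval_C] at this
        exact sub_eq_zero.1 this
      have h2 : q.eval x ≠ 0 := fun h0 =>
        denom_eval_ne_zero_of_num_eval_eq_zero (f := f) (by rw [← hp, h1, h0, mul_zero]) h0
      exact ⟨h2, by rw [h1, mul_div_cancel_right₀ _ h2]⟩
    have hfib : sphereMap f ⁻¹' {(c : OnePoint ℂ)} =
        (fun x : ℂ => (x : OnePoint ℂ)) '' (r.roots.toFinset : Set ℂ) := by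
      ext y
      simp only [Set.mem_preimage, Set.mem_singleton_iff, Set.mem_image, Finset.mem_coe,
        Multiset.mem_toFinset, mem_roots hr0]
      induction y using OnePoint.rec with
      | infty =>
        refine iff_of_false (fun h => ?_) (by simp)
        have : (if q.natDegree < p.natDegree then OnePoint.infty
          else ((p.coeff q.natDegree : ℂ) : OnePoint ℂ)) = (c : OnePoint ℂ) := h
        split_ifs at this
        · exact OnePoint.infty_ne_coe _ this
        · exact hy1 (OnePoint.coe_eq_coe.1 this).symm
      | coe x =>
        simp only [OnePoint.coe_eq_coe, exists_eq_right]
        constructor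
        · intro h
          have hx : q.eval x ≠ 0 := fun h0 => by
            rw [sphereMap_coe_eq_infty h0] at h
            exact OnePoint.infty_ne_coe _ h
          rw [sphereMap_coe_of_ne hx, OnePoint.coe_eq_coe, div_eq_iff hx] at h
          simp only [hr, IsRoot, eval_sub, eval_mul, eval_C, hp, h, hq, sub_self]
        · intro h
          rw [sphereMap_coe_of_ne (hroot h).1, (hroot h).2]
    have hnodup : r.roots.Nodup := by
      rw [Multiset.nodup_iff_count_le_one]
      intro x
      rw [count_roots]
      by_contra! hx
      obtain ⟨h1, h2⟩ := (one_lt_rootMultiplicity_iff_isRoot hr0).1 hx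
      have hW : (wronskian p q).IsRoot x := by
        have e : wronskian p q = r * derivative q - derivative r * q := by
          simp only [wronskian, hr, derivative_sub, derivative_C_mul]
          ring
        rw [IsRoot, e, eval_sub, eval_mul, eval_mul, h1.eq_zero, h2.eq_zero]
        ring
      -- By coprimality the Wronskian vanishes identically only if `p' = q' = 0`. Then `r` is a
      -- constant with a root, contradicting `r ≠ 0`.
      by_cases hW0 : wronskian p q = 0
      · obtain ⟨i, j⟩ := (f.isCoprime_num_denom.wronskian_eq_zero_iff).1 hW0
        have : derivative r = 0 := by
          rw [hr, derivative_sub, derivative_C_mul, hp, i, hq, j, mul_zero, sub_zero]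
        have hc := eq_C_of_natDegree_eq_zero (derivative_eq_zero.1 this)
        have h1 : r.eval x = 0 := h1
        rw [hc, eval_C] at h1
        rw [h1, C_0] at hc
        exact hr0 hc
      · exact hy2 ⟨x, by simpa [hW0] using hW, congrArg _ (hroot h1).2⟩
    rw [hfib, Set.ncard_image_of_injective _ OnePoint.coe_injective, Set.ncard_coe_finset,
      Multiset.toFinset_card_of_nodup hnodup, splits_iff_card_roots.1 (IsAlgClosed.splits r), hdeg]

theorem preimage_smul_singleton_eq_image {f g : RatFunc ℂ} {ε ι : GL (Fin 2) ℂ}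
    (h : ∀ x, sphereMap g (ι • x) = ε • sphereMap f x) (y : OnePoint ℂ) :
    sphereMap g ⁻¹' {ε • y} = (fun x => ι • x) '' (sphereMap f ⁻¹' {y}) := by
  ext x
  simp only [Set.mem_preimage, Set.mem_singleton_iff, Set.mem_image]
  constructor
  · intro hx
    refine ⟨ι⁻¹ • x, MulAction.injective ε ?_, smul_inv_smul _ _⟩
    simp only [← h, smul_inv_smul, hx]
  · rintro ⟨x, hx, rfl⟩
    rw [h, hx]

theorem ncard_fibre_smul {f g : RatFunc ℂ} {ε ι : GL (Fin 2) ℂ}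
    (h : ∀ x, sphereMap g (ι • x) = ε • sphereMap f x) (y : OnePoint ℂ) :
    (sphereMap g ⁻¹' {ε • y}).ncard = (sphereMap f ⁻¹' {y}).ncard := by
  rw [preimage_smul_singleton_eq_image h, Set.ncard_image_of_injective _ (MulAction.injective ι)]

theorem infinite_onePoint : (Set.univ : Set (OnePoint ℂ)).Infinite :=
  (Set.infinite_range_of_injective (OnePoint.coe_injective (X := ℂ))).mono (Set.subset_univ _)

/-- The degree is invariant under Möbius equivalence. -/
theorem MobiusEquiv.ratDegree_eq {f g : RatFunc ℂ} (h : MobiusEquiv f g) :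
    ratDegree f = ratDegree g := by
  obtain ⟨ε, ι, h⟩ := h
  obtain ⟨B, hB, hf⟩ := exists_finite_ncard_fibre_eq f
  obtain ⟨B', hB', hg⟩ := exists_finite_ncard_fibre_eq g
  obtain ⟨y, hy⟩ := (infinite_onePoint.sdiff
    (hB.union (hB'.preimage (MulAction.injective ε).injOn))).nonempty
  simp only [Set.mem_sdiff, Set.mem_univ, true_and, Set.mem_union, not_or] at hy
  rw [← hf y hy.1, ← hg _ hy.2, ncard_fibre_smul h]

/-! ### Functions that are rational in the Weierstrass function -/

/-- Off a countable set, `φ` is a rational function of the Weierstrass function. -/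
def IsRationalInP (L : PeriodPair) (φ : ℂ → ℂ) : Prop :=
  ∃ p q : ℂ[X], q ≠ 0 ∧ ∃ S : Set ℂ, S.Countable ∧
    ∀ z ∉ S, q.eval (weierstrassP L z) * φ z = p.eval (weierstrassP L z)

namespace IsRationalInP

variable {L : PeriodPair} {φ ψ : ℂ → ℂ}

theorem const (c : ℂ) : IsRationalInP L fun _ => c :=
  ⟨Polynomial.C c, 1, one_ne_zero, ∅, Set.countable_empty, by simp⟩

theorem add (h : IsRationalInP L φ) (h' : IsRationalInP L ψ) :
    IsRationalInP L fun z => φ z + ψ z := by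
  obtain ⟨p, q, hq, S, hS, e⟩ := h
  obtain ⟨p', q', hq', S', hS', e'⟩ := h'
  refine ⟨p * q' + p' * q, q * q', mul_ne_zero hq hq', S ∪ S', hS.union hS', fun z hz => ?_⟩
  simp only [Set.mem_union, not_or] at hz
  simp only [eval_add, eval_mul]
  linear_combination q'.eval (weierstrassP L z) * e z hz.1 +
    q.eval (weierstrassP L z) * e' z hz.2

theorem const_mul (c : ℂ) (h : IsRationalInP L φ) : IsRationalInP L fun z => c * φ z := by
  obtain ⟨p, q, hq, S, hS, e⟩ := h
  refine ⟨Polynomial.C c * p, q, hq, S, hS, fun z hz => ?_⟩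
  rw [eval_mul, eval_C, ← e z hz]
  ring

theorem sum {ι : Type*} (s : Finset ι) {φ : ι → ℂ → ℂ} (h : ∀ i ∈ s, IsRationalInP L (φ i)) :
    IsRationalInP L fun z => ∑ i ∈ s, φ i z := by
  classical
  induction s using Finset.induction_on with
  | empty => simpa using const 0
  | insert i s hi ih =>
    simp only [Finset.sum_insert hi]
    exact (h i (by simp)).add (ih fun j hj => h j (by simp [hj]))

theorem congr (h : IsRationalInP L φ) {S : Set ℂ} (hS : S.Countable)
    (e : ∀ z ∉ S, ψ z = φ z) : IsRationalInP L ψ := by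
  obtain ⟨p, q, hq, S', hS', e'⟩ := h
  refine ⟨p, q, hq, S ∪ S', hS.union hS', fun z hz => ?_⟩
  simp only [Set.mem_union, not_or] at hz
  rw [e z hz.1, e' z hz.2]

theorem symm_sum (L : PeriodPair) (u : ℂ) :
    IsRationalInP L fun z => weierstrassP L (z + u) + weierstrassP L (z - u) := by
  by_cases hu : u ∈ L.lattice
  · refine ⟨2 * X, 1, one_ne_zero, ∅, Set.countable_empty, fun z _ => ?_⟩
    have h1 := L.weierstrassP_add_coe z ⟨u, hu⟩
    have h2 := L.weierstrassP_sub_coe z ⟨u, hu⟩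
    simp only at h1 h2
    simp only [h1, h2, eval_one, eval_mul, eval_ofNat, eval_X]
    ring
  · obtain ⟨a, b, h⟩ := exists_sq_mul_symmSum_eq L hu
    refine ⟨Polynomial.C a * X + Polynomial.C b + Polynomial.C (2 * weierstrassP L u) *
      (X - Polynomial.C (weierstrassP L u)) ^ 2, (X - Polynomial.C (weierstrassP L u)) ^ 2,
      pow_ne_zero 2 (X_sub_C_ne_zero _), L.lattice ∪ {z | 1 * z + u ∈ L.lattice} ∪
      {z | 1 * z + -u ∈ L.lattice}, ((countable_lattice L).union
      (countable_setOf_affine_mem_lattice L one_ne_zero _)).union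
      (countable_setOf_affine_mem_lattice L one_ne_zero _), fun z hz => ?_⟩
    simp only [Set.mem_union, not_or, SetLike.mem_coe, Set.mem_ofPred_eq, one_mul,
      ← sub_eq_add_neg] at hz
    have := h z hz.1.1 hz.1.2 hz.2
    rw [symmSum] at this
    simp only [eval_add, eval_mul, eval_pow, eval_sub, eval_C, eval_X]
    linear_combination this

end IsRationalInP

/-! ### The lattices of `E_τ` and `E_{nτ}` -/

section Descent

theorem mem_periods_iff {τ : ℍ} {x : ℂ} :
    x ∈ (periods τ).lattice ↔ ∃ a b : ℤ, x = a + b * τ := by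
  rw [PeriodPair.mem_lattice]
  simp [periods, eq_comm]

theorem add_mul_coe_inj {τ : ℍ} {a b a' b' : ℝ} (h : (a + b * τ : ℂ) = a' + b' * τ) :
    a = a' ∧ b = b' := by
  have h1 := congrArg Complex.im h
  have h2 := congrArg Complex.re h
  have hb : b = b' := by simpa [τ.im_ne_zero] using h1
  subst hb
  exact ⟨by simpa using h2, rfl⟩

theorem int_div_mem_periods_iff (n : ℕ+) (τ : ℍ) (m : ℤ) :
    (m / n : ℂ) ∈ (periods τ).lattice ↔ (n : ℤ) ∣ m := by
  have hn : (n : ℂ) ≠ 0 := by exact_mod_cast n.ne_zero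
  rw [mem_periods_iff]
  constructor
  · rintro ⟨a, b, h⟩
    have := add_mul_coe_inj (τ := τ) (a := m / n) (b := 0) (a' := a) (b' := b)
      (by simpa using h)
    have h1 : (m : ℝ) = a * n := by
      rw [← this.1]
      have hn : (n : ℝ) ≠ 0 := by exact_mod_cast n.ne_zero
      field_simp
    exact ⟨a, by rw [mul_comm]; exact_mod_cast h1⟩
  · rintro ⟨a, rfl⟩
    refine ⟨a, 0, ?_⟩
    push_cast
    field_simp
    simp

theorem coe_mulTau (n : ℕ+) (τ : ℍ) : ((mulTau n τ : ℍ) : ℂ) = n * τ := rfl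

/-- The kernel of `[n]` is the cyclic group generated by `1/n`, since `n⁻¹ Λ_{1,nτ} = ℤ (1/n) + ℤ
τ`. -/
theorem mul_mem_lattice_iff (n : ℕ+) (τ : ℍ) (z : ℂ) :
    (n : ℂ) * z ∈ (periods (mulTau n τ)).lattice ↔
      ∃ k ∈ Finset.range n, z - k / n ∈ (periods τ).lattice := by
  have hn : (n : ℂ) ≠ 0 := by exact_mod_cast n.ne_zero
  have hn' : (0 : ℤ) < n := by exact_mod_cast n.pos
  simp only [mem_periods_iff, coe_mulTau, Finset.mem_range]
  constructor
  · rintro ⟨a, b, h⟩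
    have h1 := Int.emod_nonneg a hn'.ne'
    have h2 := Int.emod_lt_of_pos a hn'
    refine ⟨(a % n).toNat, by omega, a / n, b, ?_⟩
    have h3 : (((a % n).toNat : ℕ) : ℂ) = ((a % n : ℤ) : ℂ) := by
      rw [← Int.cast_natCast, Int.toNat_of_nonneg h1]
    have h4 : (a : ℂ) = n * ((a / n : ℤ) : ℂ) + ((a % n : ℤ) : ℂ) := by
      exact_mod_cast (Int.mul_ediv_add_emod a n).symm
    rw [h3]
    refine mul_left_cancel₀ hn ?_
    rw [mul_sub, h, mul_div_cancel₀ _ hn, h4]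
    ring
  · rintro ⟨k, -, a, b, h⟩
    refine ⟨n * a + k, b, ?_⟩
    have : z = a + b * τ + k / n := by rw [← h]; ring
    rw [this]
    push_cast
    field_simp
    ring

theorem eq_of_sub_div_mem_lattice {n : ℕ+} {τ : ℍ} {z : ℂ} {k l : ℕ}
    (hk : k ∈ Finset.range n) (hl : l ∈ Finset.range n)
    (hk' : z - k / n ∈ (periods τ).lattice) (hl' : z - l / n ∈ (periods τ).lattice) : k = l := by
  have h := sub_mem hl' hk'
  have e : z - l / n - (z - k / n) = (((k : ℤ) - (l : ℤ) : ℤ) : ℂ) / n := by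
    push_cast
    ring
  rw [e, int_div_mem_periods_iff] at h
  rw [Finset.mem_range] at hk hl
  have := Int.eq_zero_of_abs_lt_dvd h (by rw [abs_lt]; omega)
  omega

theorem isDescent_iff {n : ℕ+} {τ : ℍ} {f : RatFunc ℂ} : IsDescent n τ f ↔
    ∀ z, sphereMap f (toSphere (periods τ) z) = toSphere (periods (mulTau n τ)) (n * z) := by
  constructor
  · intro h z
    exact h (Submodule.Quotient.mk z)
  · intro h P
    obtain ⟨z, rfl⟩ := Submodule.Quotient.mk_surjective _ P
    exact h z

open Classical in
theorem isRationalInP_mul (n : ℕ+) (τ : ℍ) :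
    IsRationalInP (periods τ) fun z => weierstrassP (periods (mulTau n τ)) (n * z) := by
  set L := periods τ
  set L' := periods (mulTau n τ)
  have hn : (n : ℂ) ≠ 0 := by exact_mod_cast n.ne_zero
  -- The factor `n ^ 2` makes the leading coefficients at the poles equal to `1`; each pole of the
  -- first term is a pole of exactly one summand.
  set D : ℂ → ℂ := fun z => (n : ℂ) ^ 2 * weierstrassP L' (n * z) -
    ∑ k ∈ Finset.range n, weierstrassP L (z - k / n) with hD
  have hper : ∀ l ∈ L.lattice, ∀ z, D (z + l) = D z := by
    intro l hl z
    have hl' : (n : ℂ) * l ∈ L'.lattice := lattice_le_comap n τ hl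
    simp only [hD, mul_add]
    rw [L'.weierstrassP_add_coe _ ⟨_, hl'⟩]
    congr 1
    refine Finset.sum_congr rfl fun k _ => ?_
    rw [add_sub_right_comm, L.weierstrassP_add_coe _ ⟨l, hl⟩]
  have hreg : ∀ z, HasDoublePole D z 0 := by
    intro z
    have h1 := (HasDoublePole.comp_affine (z₀ := z) (d := 0) hn
      (hasDoublePole_weierstrassP L' _)).const_mul ((n : ℂ) ^ 2)
    have h2 := HasDoublePole.sum (z₀ := z) (Finset.range n) fun k _ =>
      HasDoublePole.comp_affine (z₀ := z) (c := 1) (d := -((k : ℂ) / n)) one_ne_zero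
        (hasDoublePole_weierstrassP L _)
    have h3 := h1.sub h2
    simp only [add_zero, one_mul, ← sub_eq_add_neg, one_pow, div_one] at h3
    convert h3 using 1
    rw [mul_div_cancel₀ _ (pow_ne_zero 2 hn)]
    by_cases hz : (n : ℂ) * z ∈ L'.lattice
    · obtain ⟨k, hk, hk'⟩ := (mul_mem_lattice_iff n τ z).1 hz
      rw [if_pos hz, Finset.sum_eq_single k, if_pos hk', sub_self]
      · intro l hl hlk
        exact if_neg fun hl' => hlk (eq_of_sub_div_mem_lattice hl hk hl' hk')
      · exact fun h => absurd hk h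
    · rw [if_neg hz, Finset.sum_eq_zero, sub_zero]
      exact fun k hk => if_neg fun hk' => hz ((mul_mem_lattice_iff n τ z).2 ⟨k, hk, hk'⟩)
  obtain ⟨c, hc⟩ := eventuallyEq_const_of_periodic L hper hreg
  have hval (z : ℂ) (hz : (n : ℂ) * z ∉ L'.lattice) : D z = c := by
    have h1 : ContinuousAt (fun z => (n : ℂ) ^ 2 * weierstrassP L' (n * z)) z := by
      have : AnalyticAt ℂ (fun z => weierstrassP L' (n * z)) z :=
        AnalyticAt.fun_comp (L'.analyticOnNhd_weierstrassP _ hz) (by fun_prop)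
      have := this.continuousAt
      fun_prop
    have h2 : ContinuousAt D z := by
      refine h1.sub (tendsto_finsetSum _ fun k hk => ?_)
      have : AnalyticAt ℂ (fun z => weierstrassP L (z - k / n)) z :=
        AnalyticAt.fun_comp (L.analyticOnNhd_weierstrassP _ fun hk' =>
          hz ((mul_mem_lattice_iff n τ z).2 ⟨k, hk, hk'⟩)) (by fun_prop)
      exact this.continuousAt
    exact tendsto_nhds_unique (h2.tendsto.mono_left nhdsWithin_le_nhds)
      (tendsto_const_nhds.congr' (hc z).symm)
  have hrat := (((IsRationalInP.sum (Finset.range n) fun k _ =>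
    IsRationalInP.symm_sum L ((k : ℂ) / n)).add (IsRationalInP.const (2 * c))).const_mul
      (1 / (2 * (n : ℂ) ^ 2)))
  refine hrat.congr (countable_setOf_affine_mem_lattice L' hn 0) fun z hz => ?_
  have hz : (n : ℂ) * z ∉ L'.lattice := by simpa using hz
  have e1 := hval z hz
  -- Adding the values at `z` and `-z` pairs the shifts by `k/n` and `-k/n`, as `symm_sum` requires.
  have e2 := hval (-z) (by simpa using hz)
  have e3 : ∑ k ∈ Finset.range n, weierstrassP L (-z - k / n) =
      ∑ k ∈ Finset.range n, weierstrassP L (z + k / n) := by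
    refine Finset.sum_congr rfl fun k _ => ?_
    rw [← L.weierstrassP_neg]
    ring_nf
  simp only [hD, mul_neg, L'.weierstrassP_neg, e3] at e1 e2
  rw [Finset.sum_add_distrib, div_mul_eq_mul_div, one_mul,
    eq_div_iff (mul_ne_zero two_ne_zero (pow_ne_zero 2 hn))]
  linear_combination e1 + e2

theorem tendsto_mul_nhdsNE {c : ℂ} (hc : c ≠ 0) (z : ℂ) :
    Tendsto (fun w => c * w) (𝓝[≠] z) (𝓝[≠] (c * z)) := by
  refine tendsto_nhdsWithin_of_tendsto_nhds_of_eventually_within _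
    (Continuous.tendsto (by fun_prop) z |>.mono_left nhdsWithin_le_nhds) ?_
  filter_upwards [self_mem_nhdsWithin] with w hw hw'
  exact hw (mul_left_cancel₀ hc hw')

theorem exists_isDescent (n : ℕ+) (τ : ℍ) : ∃ f, IsDescent n τ f := by
  have hn : (n : ℂ) ≠ 0 := by exact_mod_cast n.ne_zero
  obtain ⟨p, q, hq, S, hS, hpq⟩ := isRationalInP_mul n τ
  set L := periods τ with hL
  set L' := periods (mulTau n τ) with hL'
  set φ : ℂ → ℂ := fun z => weierstrassP L' (n * z) with hφ
  set f : RatFunc ℂ := algebraMap _ _ p / algebraMap _ _ q with hf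
  have hcross : f.num * q = p * f.denom := (RatFunc.num_mul_eq_mul_denom_iff hq).2 rfl
  have hlat {z : ℂ} (hz : z ∈ L.lattice) : (n : ℂ) * z ∈ L'.lattice := lattice_le_comap n τ hz
  have hφa {z : ℂ} (hz : (n : ℂ) * z ∉ L'.lattice) : ContinuousAt φ z :=
    (AnalyticAt.fun_comp (f := fun z => (n : ℂ) * z)
      (L'.analyticOnNhd_weierstrassP _ hz) (by fun_prop)).continuousAt
  have hφp {z : ℂ} (hz : (n : ℂ) * z ∈ L'.lattice) :
      Tendsto φ (𝓝[≠] z) (Bornology.cobounded ℂ) :=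
    (tendsto_weierstrassP_cobounded L' hz).comp (tendsto_mul_nhdsNE hn z)
  have hS₁ : (S ∪ ⋃ x ∈ q.roots.toFinset, {z | toSphere L z = (x : OnePoint ℂ)} ∪
      L.lattice).Countable := by
    refine hS.union ((q.roots.toFinset.countable_toSet.biUnion fun x _ => ?_))
    exact (countable_toSphere_fibre L _).union (countable_lattice L)
  -- By density and continuity, the relation for `p, q` passes to lowest terms and to every point
  -- where `φ` is finite.
  have hcross' {z : ℂ} (hz : (n : ℂ) * z ∉ L'.lattice) :
      f.denom.eval (weierstrassP L z) * φ z = f.num.eval (weierstrassP L z) := by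
    have hzL : z ∉ L.lattice := fun h => hz (hlat h)
    by_contra hne
    have h1 := hφa hz
    have h2 := (L.analyticOnNhd_weierstrassP z hzL).continuousAt
    have h3 : ContinuousAt (fun z => f.denom.eval (weierstrassP L z) * φ z -
        f.num.eval (weierstrassP L z)) z :=
      ((f.denom.continuous.continuousAt.comp h2).mul h1).sub
        (f.num.continuous.continuousAt.comp h2)
    have h4 := h3.eventually_ne (sub_ne_zero.2 hne)
    have h5 : ∀ᶠ w in 𝓝 z, w ∉ L.lattice := L.isClosed_lattice.isOpen_compl.mem_nhds hzL
    obtain ⟨w, hw, hw4, hw5⟩ := ((mem_closure_iff_frequently.1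
      ((Set.Countable.dense_compl ℝ hS₁) z)).and_eventually (h4.and h5)).exists
    refine hw4 (sub_eq_zero.2 ?_)
    simp only [Set.mem_compl_iff, Set.mem_union, Set.mem_iUnion, not_or, not_exists,
      Multiset.mem_toFinset, Set.mem_ofPred_eq, toSphere_eq_coe_iff] at hw
    have hqw : q.eval (weierstrassP L w) ≠ 0 := fun h0 =>
      (hw.2 (weierstrassP L w) ((mem_roots hq).2 h0)).1 ⟨hw5, rfl⟩
    refine mul_left_cancel₀ hqw ?_
    have e1 := hpq w hw.1
    have e2 := congrArg (Polynomial.eval (weierstrassP L w)) hcross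
    simp only [eval_mul] at e2
    linear_combination f.denom.eval (weierstrassP L w) * e1 - e2
  refine ⟨f, isDescent_iff.2 fun z => ?_⟩
  by_cases hz : z ∈ L.lattice
  · rw [toSphere_of_mem L hz, toSphere_of_mem L' (hlat hz)]
    refine sphereMap_infty_of_lt ?_
    -- Otherwise `num / denom` stays bounded as `℘ → ∞`, although `φ` has a pole at `z`.
    by_contra! hdeg
    have hO := isBigO_cobounded_of_degree_le (P := f.num) (Q := f.denom)
      (by rw [degree_eq_natDegree f.denom_ne_zero]; exact degree_le_of_natDegree_le hdeg) |>.comp_tendsto (tendsto_weierstrassP_cobounded L hz)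
    obtain ⟨C, hC⟩ := hO.bound
    have hne : ∀ᶠ w in 𝓝[≠] z, f.denom.eval (weierstrassP L w) ≠ 0 := by
      have hfin := Polynomial.eventually_cofinite_not_isRoot f.denom_ne_zero
      exact (tendsto_weierstrassP_cobounded L hz).eventually
        (Bornology.le_cofinite ℂ hfin)
    have hlarge := (hφp (hlat hz)).eventually (eventually_cobounded_le_norm (C + 1))
    have hnl : ∀ᶠ w in 𝓝[≠] z, (n : ℂ) * w ∉ L'.lattice :=
      (tendsto_mul_nhdsNE hn z).eventually (eventually_notMem_lattice L' _)
    obtain ⟨w, ⟨⟨hw1, hw2⟩, hw3⟩, hw4⟩ := (((hC.and hne).and hlarge).and hnl).exists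
    simp only [Function.comp_apply] at hw1
    rw [← hcross' hw4, norm_mul, mul_comm] at hw1
    have := le_of_mul_le_mul_right hw1 (norm_pos_iff.2 hw2)
    linarith
  · rw [toSphere_of_notMem L hz]
    by_cases hz' : (n : ℂ) * z ∈ L'.lattice
    · rw [toSphere_of_mem L' hz']
      refine sphereMap_coe_eq_infty ?_
      by_contra hne
      have h2 := (L.analyticOnNhd_weierstrassP z hz).continuousAt
      have h3 : ContinuousAt (fun w => f.num.eval (weierstrassP L w) /
          f.denom.eval (weierstrassP L w)) z :=
        (f.num.continuous.continuousAt.comp h2).div (f.denom.continuous.continuousAt.comp h2) hne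
      have h4 : ∀ᶠ w in 𝓝[≠] z, f.denom.eval (weierstrassP L w) ≠ 0 :=
        nhdsWithin_le_nhds ((f.denom.continuous.continuousAt.comp h2).eventually_ne hne)
      have hnl : ∀ᶠ w in 𝓝[≠] z, (n : ℂ) * w ∉ L'.lattice :=
        (tendsto_mul_nhdsNE hn z).eventually (eventually_notMem_lattice L' _)
      refine (hφp hz').not_tendsto (Metric.disjoint_cobounded_nhds _)
        ((h3.tendsto.mono_left nhdsWithin_le_nhds).congr' ?_)
      filter_upwards [h4, hnl] with w h4 h5
      rw [div_eq_iff h4, ← hcross' h5, mul_comm]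
    · have h := hcross' hz'
      have hne : f.denom.eval (weierstrassP L z) ≠ 0 := fun h0 => by
        rw [h0, zero_mul] at h
        exact denom_eval_ne_zero_of_num_eval_eq_zero h.symm h0
      rw [toSphere_of_notMem L' hz', sphereMap_coe_of_ne hne, ← h, mul_div_cancel_left₀ _ hne]

theorem isDescent_descent (n : ℕ+) (τ : ℍ) : IsDescent n τ (descent n τ) :=
  Classical.epsilon_spec (exists_isDescent n τ)

theorem sphereMap_descent (n : ℕ+) (τ : ℍ) (z : ℂ) :
    sphereMap (descent n τ) (toSphere (periods τ) z) = toSphere (periods (mulTau n τ)) (n * z) :=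
  isDescent_iff.1 (isDescent_descent n τ) z

theorem IsDescent.eq_descent {n : ℕ+} {τ : ℍ} {f : RatFunc ℂ} (h : IsDescent n τ f) :
    f = descent n τ := by
  refine sphereMap_injective (funext fun x => ?_)
  obtain ⟨z, rfl⟩ := toSphere_surjective (periods τ) x
  rw [isDescent_iff.1 h, sphereMap_descent]

end Descent

/-! ### The fibres of `n_τ` -/

section Fibre

variable (n : ℕ+) (τ : ℍ)

theorem pnat_coe_ne_zero : ((n : ℕ) : ℂ) ≠ 0 := by exact_mod_cast n.ne_zero

theorem int_mem_periods (m : ℤ) : (m : ℂ) ∈ (periods τ).lattice :=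
  mem_periods_iff.2 ⟨m, 0, by simp⟩

theorem nat_mem_periods (m : ℕ) : (m : ℂ) ∈ (periods τ).lattice := by
  simpa using int_mem_periods τ m

theorem descent_fibre (v : ℂ) :
    sphereMap (descent n τ) ⁻¹' {toSphere (periods (mulTau n τ)) v} =
      (fun k : ℕ => toSphere (periods τ) ((v + k) / n)) '' (Finset.range n : Set ℕ) := by
  have hn := pnat_coe_ne_zero n
  ext x
  obtain ⟨z, rfl⟩ := toSphere_surjective (periods τ) x
  simp only [Set.mem_preimage, Set.mem_singleton_iff, sphereMap_descent, Set.mem_image,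
    Finset.mem_coe]
  constructor
  · intro h
    have key (z : ℂ) (h : n * z - v ∈ (periods (mulTau n τ)).lattice) :
        ∃ k ∈ Finset.range n, toSphere (periods τ) ((v + k) / n) = toSphere (periods τ) z := by
      have e : n * z - v = n * (z - v / n) := by rw [mul_sub, mul_div_cancel₀ _ hn]
      rw [e] at h
      obtain ⟨k, hk, hk'⟩ := (mul_mem_lattice_iff n τ _).1 h
      refine ⟨k, hk, Eq.symm ((toSphere_eq_iff _).2 (Or.inl ?_))⟩
      convert hk' using 1
      ring
    rcases (toSphere_eq_iff _).1 h with h | h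
    · exact key z h
    · rw [← toSphere_neg]
      refine key (-z) ?_
      convert neg_mem h using 1
      ring
  · rintro ⟨k, -, hk⟩
    have h := congrArg (sphereMap (descent n τ)) hk
    rw [sphereMap_descent, sphereMap_descent, mul_div_cancel₀ _ hn] at h
    rw [← h, toSphere_add_coe _ _ (nat_mem_periods _ k)]

/-- Points with different indices can coincide only by reflection, which forces `2v + k + l ∈
Λ_{1,nτ}` and hence `2v ∈ Λ_{1,nτ}`. -/
theorem ncard_descent_fibre {v : ℂ} (hv : 2 * v ∉ (periods (mulTau n τ)).lattice) :
    (sphereMap (descent n τ) ⁻¹' {toSphere (periods (mulTau n τ)) v}).ncard = n := by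
  have hn := pnat_coe_ne_zero n
  rw [descent_fibre, Set.InjOn.ncard_image, Set.ncard_coe_finset, Finset.card_range]
  intro k hk l hl h
  rcases (toSphere_eq_iff _).1 h with h | h
  · refine eq_of_sub_div_mem_lattice (n := n) (τ := τ) (z := k / n) hk hl (by simp) ?_
    convert h using 1
    ring
  · have h' := lattice_le_comap n τ h
    rw [Submodule.mem_comap, LinearMap.mulLeft_apply] at h'
    refine absurd ?_ hv
    convert sub_mem h' (nat_mem_periods (mulTau n τ) (k + l)) using 1
    push_cast
    field_simp
    ring

theorem ncard_descent_fibre_lt (hn3 : 3 ≤ n) {v : ℂ}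
    (hv : 2 * v ∈ (periods (mulTau n τ)).lattice) :
    (sphereMap (descent n τ) ⁻¹' {toSphere (periods (mulTau n τ)) v}).ncard < n := by
  have hn := pnat_coe_ne_zero n
  have hn3 : 3 ≤ (n : ℕ) := hn3
  obtain ⟨a, b, hab⟩ := mem_periods_iff.1 hv
  rw [coe_mulTau] at hab
  -- Reflection identifies the indices `k` and `l` when `n ∣ a + k + l`. If `n ∣ a`, the pair `1, n
  -- - 1` consists of distinct indices because `n ≥ 3`.
  obtain ⟨k, l, hk, hl, hkl, hdvd⟩ : ∃ k l : ℕ, k < n ∧ l < n ∧ k ≠ l ∧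
      (n : ℤ) ∣ a + k + l := by
    by_cases ha : (n : ℤ) ∣ a
    · refine ⟨1, n - 1, by omega, by omega, by omega, ?_⟩
      have : a + ((1 : ℕ) : ℤ) + ((n - 1 : ℕ) : ℤ) = a + n := by omega
      rw [this]
      exact dvd_add ha dvd_rfl
    · have hn0 : (0 : ℤ) < n := by omega
      have h1 := Int.emod_nonneg (-a) hn0.ne'
      have h2 := Int.emod_lt_of_pos (-a) hn0
      have h3 : (-a) % n ≠ 0 := fun h => ha ((dvd_neg).1 (Int.dvd_of_emod_eq_zero h))
      refine ⟨0, ((-a) % n).toNat, by omega, by omega, by omega, ?_⟩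
      rw [Int.toNat_of_nonneg h1]
      refine Int.dvd_of_emod_eq_zero ?_
      simp
  have hle := Set.ncard_image_le (f := fun k : ℕ => toSphere (periods τ) ((v + k) / n))
    (Finset.range n).finite_toSet
  rw [descent_fibre]
  rw [Set.ncard_coe_finset, Finset.card_range] at hle
  refine lt_of_le_of_ne hle fun h => hkl ?_
  have hinj := (Set.ncard_image_iff (Finset.range n).finite_toSet).1
    (h.trans (by rw [Set.ncard_coe_finset, Finset.card_range]))
  refine hinj (by simpa using hk) (by simpa using hl) ((toSphere_eq_iff _).2 (Or.inr ?_))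
  have e : (v + k) / n + (v + l) / n = ((a + k + l : ℤ) : ℂ) / n + ((b : ℤ) : ℂ) * τ := by
    push_cast
    field_simp
    linear_combination hab
  simp only [e]
  exact add_mem ((int_div_mem_periods_iff n τ _).2 hdvd)
    (mem_periods_iff.2 ⟨0, b, by simp⟩)

theorem ratDegree_descent : ratDegree (descent n τ) = n := by
  obtain ⟨B, hB, h⟩ := exists_finite_ncard_fibre_eq (descent n τ)
  obtain ⟨v, hv⟩ := exists_notMem_of_countable ((countable_setOf_affine_mem_lattice
    (periods (mulTau n τ)) (two_ne_zero (α := ℂ)) 0).union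
    (hB.countable.biUnion fun y _ => countable_toSphere_fibre (periods (mulTau n τ)) y))
  simp only [add_zero, Set.mem_union, Set.mem_ofPred_eq, Set.mem_iUnion, not_or, not_exists] at hv
  rw [← h _ fun hmem => hv.2 _ hmem rfl, ncard_descent_fibre n τ hv.1]

theorem mem_branchSet_iff (hn3 : 3 ≤ n) (y : OnePoint ℂ) :
    y ∈ branchSet (periods (mulTau n τ)) ↔ (sphereMap (descent n τ) ⁻¹' {y}).ncard < n := by
  constructor
  · rintro ⟨v, hv, rfl⟩
    exact ncard_descent_fibre_lt n τ hn3 hv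
  · obtain ⟨v, rfl⟩ := toSphere_surjective (periods (mulTau n τ)) y
    intro h
    refine ⟨v, ?_, rfl⟩
    by_contra hv
    exact h.ne (ncard_descent_fibre n τ hv)

end Fibre

/-! ### From Möbius equivalence to homothety of lattices -/

theorem frequently_nhdsNE_notMem {S : Set ℂ} (hS : S.Countable) (z₀ : ℂ) :
    ∃ᶠ z in 𝓝[≠] z₀, z ∉ S := by
  have h := mem_closure_iff_frequently.1
    (Set.Countable.dense_compl ℝ (hS.union (Set.countable_singleton z₀)) z₀)
  rw [frequently_nhdsWithin_iff]
  refine h.mono fun z hz => ?_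
  simp only [Set.mem_compl_iff, Set.mem_union, not_or] at hz
  exact hz

theorem exists_homothety_of_mobiusEquiv {n : ℕ+} (hn3 : 3 ≤ n) {τ₁ τ₂ : ℍ}
    (h : MobiusEquiv (descent n τ₁) (descent n τ₂)) : ∃ α : ℂ,
      (∀ ω, ω ∈ (periods τ₁).lattice ↔ α * ω ∈ (periods τ₂).lattice) ∧
      ∀ ω, ω ∈ (periods (mulTau n τ₁)).lattice ↔ α * ω ∈ (periods (mulTau n τ₂)).lattice := by
  obtain ⟨ε, ι, h⟩ := h
  have hn := pnat_coe_ne_zero n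
  obtain ⟨α, β, hα, S, hS, hlift⟩ := exists_affine_lift
    (L₁ := periods (mulTau n τ₁)) (L₂ := periods (mulTau n τ₂)) (ε := ε) fun x hx => by
      rw [mem_branchSet_iff n _ hn3] at hx ⊢
      rwa [ncard_fibre_smul h]
  refine ⟨α, ?_, mem_lattice_iff_of_smul_toSphere_eq hα hS hlift⟩
  have hS' : {z : ℂ | (n : ℂ) * z ∈ S}.Countable := hS.preimage (mul_right_injective₀ hn)
  have hfib (z : ℂ) (hz : (n : ℂ) * z ∉ S) : ∃ k ∈ Finset.range n,
      ι • toSphere (periods τ₁) z = toSphere (periods τ₂) (α * z + (β + (k : ℕ)) / n) := by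
    have h1 : sphereMap (descent n τ₂) (ι • toSphere (periods τ₁) z) =
        toSphere (periods (mulTau n τ₂)) (α * (n * z) + β) := by
      rw [h, sphereMap_descent, hlift _ hz]
    have h2 : ι • toSphere (periods τ₁) z ∈ sphereMap (descent n τ₂) ⁻¹'
        {toSphere (periods (mulTau n τ₂)) (α * (n * z) + β)} := h1
    rw [descent_fibre] at h2
    obtain ⟨k, hk, hk'⟩ := h2
    refine ⟨k, hk, ?_⟩
    have e : α * z + (β + k) / n = (α * (n * z) + β + k) / n := by
      field_simp
      ring
    rw [e]
    exact hk'.symm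
  obtain ⟨z₀, hz₀⟩ := exists_notMem_of_countable (((countable_lattice (periods τ₁)).union
    (countable_toSphere_fibre (periods τ₁) (ι⁻¹ • OnePoint.infty))).union
    ((Finset.range n).countable_toSet.biUnion fun k _ =>
      countable_setOf_affine_mem_lattice (periods τ₂) hα ((β + k) / n)))
  simp only [Set.mem_union, not_or, SetLike.mem_coe, Set.mem_ofPred_eq, Set.mem_iUnion,
    not_exists, eq_inv_smul_iff] at hz₀
  obtain ⟨⟨h1, h3⟩, h2⟩ := hz₀
  -- In `hfib` the index `k` depends on `z`. As there are finitely many, one occurs frequently near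
  -- `z₀`, and the identity theorem spreads it.
  obtain ⟨k, hk, hfreq⟩ : ∃ k ∈ Finset.range n, ∃ᶠ z in 𝓝[≠] z₀,
      ι • toSphere (periods τ₁) z = toSphere (periods τ₂) (α * z + (β + (k : ℕ)) / n) := by
    by_contra! hcon
    obtain ⟨z, hz, hz'⟩ := ((frequently_nhdsNE_notMem hS' z₀).and_eventually
      ((Finset.eventually_all _).2 hcon)).exists
    obtain ⟨k, hk, e⟩ := hfib z hz
    exact hz' k hk e
  obtain ⟨T, hT, hT'⟩ := smul_toSphere_eq_of_frequently hα h1 (h2 k hk) h3 hfreq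
  exact mem_lattice_iff_of_smul_toSphere_eq hα hT hT'

/-- Homothetic pairs of lattices `Λ_{1,τ} ⊇ Λ_{1,nτ}` come from the same `Γ₀(n)`-orbit. -/
theorem mem_orbit_of_homothety {n : ℕ+} {τ₁ τ₂ : ℍ} {α : ℂ}
    (h : ∀ ω, ω ∈ (periods τ₁).lattice ↔ α * ω ∈ (periods τ₂).lattice)
    (h' : ∀ ω, ω ∈ (periods (mulTau n τ₁)).lattice ↔ α * ω ∈ (periods (mulTau n τ₂)).lattice) :
    τ₁ ∈ MulAction.orbit (CongruenceSubgroup.Gamma0 n) τ₂ := by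
  -- The matrix is read off here: `α ∈ Λ_{1,nτ₂}` gives the lower row `(n c, d)`, and `α τ₁ ∈
  -- Λ_{1,τ₂}` gives the upper row `(a, b)`.
  obtain ⟨d, c, hdc⟩ := mem_periods_iff.1
    ((h' 1).1 (by simpa using int_mem_periods (mulTau n τ₁) 1))
  obtain ⟨b, a, hba⟩ := mem_periods_iff.1 ((h τ₁).1 (mem_periods_iff.2 ⟨0, 1, by simp⟩))
  rw [coe_mulTau, mul_one] at hdc
  have hα : α ≠ 0 := by
    rintro rfl
    have := (h (1 / 2)).2 (by simp)
    obtain ⟨p, q, hpq⟩ := mem_periods_iff.1 this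
    have := (add_mul_coe_inj (τ := τ₁) (a := 1 / 2) (b := 0) (a' := p) (b' := q)
      (by simpa using hpq)).1
    have h2 : ((1 : ℤ) : ℝ) = ((2 * p : ℤ) : ℝ) := by
      push_cast
      linarith
    have h3 : (1 : ℤ) = 2 * p := by exact_mod_cast h2
    omega
  -- The preimages of `1` and `τ₂` provide an inverse matrix, so the determinant is a unit;
  -- comparing imaginary parts later makes it positive.
  obtain ⟨p, q, hpq⟩ := mem_periods_iff.1 ((h α⁻¹).2 (by
    rw [mul_inv_cancel₀ hα]
    simpa using int_mem_periods τ₂ 1))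
  obtain ⟨r, s, hrs⟩ := mem_periods_iff.1 ((h (α⁻¹ * τ₂)).2 (by
    rw [mul_inv_cancel_left₀ hα]
    exact mem_periods_iff.2 ⟨0, 1, by simp⟩))
  have e1 : (1 : ℂ) = (p * d + q * b) + (p * (n * c) + q * a) * τ₂ := by
    have : (1 : ℂ) = α * α⁻¹ := (mul_inv_cancel₀ hα).symm
    rw [hpq] at this
    linear_combination this + (p : ℂ) * hdc + (q : ℂ) * hba
  have e2 : (τ₂ : ℂ) = (r * d + s * b) + (r * (n * c) + s * a) * τ₂ := by
    have : (τ₂ : ℂ) = α * (α⁻¹ * τ₂) := (mul_inv_cancel_left₀ hα _).symm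
    rw [hrs] at this
    linear_combination this + (r : ℂ) * hdc + (s : ℂ) * hba
  obtain ⟨f1, f2⟩ := add_mul_coe_inj (τ := τ₂) (a := 1) (b := 0)
    (a' := ((p * d + q * b : ℤ) : ℝ)) (b' := ((p * (n * c) + q * a : ℤ) : ℝ))
    (by push_cast; linear_combination e1)
  obtain ⟨f3, f4⟩ := add_mul_coe_inj (τ := τ₂) (a := 0) (b := 1)
    (a' := ((r * d + s * b : ℤ) : ℝ)) (b' := ((r * (n * c) + s * a : ℤ) : ℝ))
    (by push_cast; linear_combination e2)
  have f1 : p * d + q * b = 1 := by exact_mod_cast f1.symm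
  have f2 : p * (n * c) + q * a = 0 := by exact_mod_cast f2.symm
  have f3 : r * d + s * b = 0 := by exact_mod_cast f3.symm
  have f4 : r * (n * c) + s * a = 1 := by exact_mod_cast f4.symm
  have hunit : (p * s - q * r) * (a * d - b * (n * c)) = 1 := by
    linear_combination (r * (n * c) + s * a) * f1 - (r * d + s * b) * f2 + f4
  have hmob : (τ₁ : ℂ) * ((n * c : ℤ) * τ₂ + d) = a * τ₂ + b := by
    push_cast
    linear_combination hba - (τ₁ : ℂ) * hdc
  have hpos : (0 : ℝ) < ((a * d - b * (n * c) : ℤ) : ℝ) := by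
    have hre := congrArg Complex.re hmob
    have him := congrArg Complex.im hmob
    simp only [Complex.mul_re, Complex.mul_im, Complex.add_re, Complex.add_im, Complex.intCast_re,
      Complex.intCast_im, zero_mul, sub_zero, add_zero, UpperHalfPlane.coe_re,
      UpperHalfPlane.coe_im] at hre him
    have key : τ₁.im * ((((n * c : ℤ) : ℝ) * τ₂.re + d) ^ 2 + (((n * c : ℤ) : ℝ) * τ₂.im) ^ 2) =
        τ₂.im * ((a * d - b * (n * c) : ℤ) : ℝ) := by
      push_cast at hre him ⊢
      linear_combination ((n * c : ℝ) * τ₂.re + d) * him - ((n * c : ℝ) * τ₂.im) * hre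
    have hne : ((a * d - b * (n * c) : ℤ) : ℝ) ≠ 0 := by
      intro h0
      have : a * d - b * (n * c) = 0 := by exact_mod_cast h0
      rw [this, mul_zero] at hunit
      exact zero_ne_one hunit
    refine lt_of_le_of_ne ?_ hne.symm
    refine nonneg_of_mul_nonneg_right (a := τ₂.im) ?_ τ₂.im_pos
    rw [← key]
    have := τ₁.im_pos
    positivity
  have hdet : a * d - b * (n * c) = 1 := by
    rcases Int.eq_one_or_neg_one_of_mul_eq_one (by rw [mul_comm] at hunit; exact hunit) with h | h
    · exact h
    · rw [h] at hpos
      norm_num at hpos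
  let γ : Matrix.SpecialLinearGroup (Fin 2) ℤ :=
    ⟨!![a, b; n * c, d], by rw [Matrix.det_fin_two_of, hdet]⟩
  have hγ : γ ∈ CongruenceSubgroup.Gamma0 n := by
    rw [CongruenceSubgroup.Gamma0_mem]
    simp [γ]
  refine ⟨⟨γ, hγ⟩, ?_⟩
  change γ • τ₂ = τ₁
  ext
  rw [UpperHalfPlane.coe_specialLinearGroup_apply]
  have hne : ((n * c : ℤ) : ℂ) * τ₂ + d ≠ 0 := by
    have : α = ((n * c : ℤ) : ℂ) * τ₂ + d := by
      rw [hdc]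
      push_cast
      ring
    rwa [← this]
  simp only [γ, Matrix.of_apply, Matrix.cons_val', Matrix.cons_val_zero, Matrix.cons_val_one,
    Matrix.cons_val_fin_one, algebraMap_int_eq, eq_intCast, Complex.ofReal_intCast]
  rw [div_eq_iff hne, hmob]

/-! ### From homothety of lattices to Möbius equivalence -/

/-- The defining series is reindexed along `l ↦ α l`; each term is homogeneous of degree `-2`. -/
theorem weierstrassP_homothety {L₁ L₂ : PeriodPair} {α : ℂ} (hα : α ≠ 0)
    (h : ∀ ω, ω ∈ L₁.lattice ↔ α * ω ∈ L₂.lattice) (z : ℂ) :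
    weierstrassP L₂ (α * z) = (α ^ 2)⁻¹ * weierstrassP L₁ z := by
  let e : L₁.lattice ≃ L₂.lattice :=
    { toFun := fun l => ⟨α * l, (h l).1 l.2⟩
      invFun := fun l => ⟨α⁻¹ * l, (h _).2 (by rw [mul_inv_cancel_left₀ hα]; exact l.2)⟩
      left_inv := fun l => Subtype.ext (inv_mul_cancel_left₀ hα _)
      right_inv := fun l => Subtype.ext (mul_inv_cancel_left₀ hα _) }
  rw [weierstrassP, weierstrassP, ← e.tsum_eq, ← tsum_mul_left]
  congr 1 with l
  simp only [e, Equiv.coe_fn_mk]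
  rw [← mul_sub, mul_pow, mul_pow, one_div, one_div, one_div, one_div, mul_inv, mul_inv, mul_sub]

/-- The Möbius transformation `x ↦ α⁻² x`. -/
def scaling (α : ℂ) (hα : α ≠ 0) : GL (Fin 2) ℂ :=
  Matrix.GeneralLinearGroup.mkOfDetNeZero !![(α ^ 2)⁻¹, 0; 0, 1] (by simpa using hα)

theorem scaling_smul_toSphere {L₁ L₂ : PeriodPair} {α : ℂ} (hα : α ≠ 0)
    (h : ∀ ω, ω ∈ L₁.lattice ↔ α * ω ∈ L₂.lattice) (z : ℂ) :
    scaling α hα • toSphere L₁ z = toSphere L₂ (α * z) := by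
  by_cases hz : z ∈ L₁.lattice
  · rw [toSphere_of_mem _ hz, toSphere_of_mem _ ((h z).1 hz), OnePoint.smul_infty_eq_self_iff]
    simp [scaling, Matrix.GeneralLinearGroup.mkOfDetNeZero]
  · rw [toSphere_of_notMem _ hz, toSphere_of_notMem _ (fun h' => hz ((h z).2 h')),
      weierstrassP_homothety hα h, smul_coe_eq_coe_iff]
    simp [scaling, Matrix.GeneralLinearGroup.mkOfDetNeZero]

theorem mobiusEquiv_of_homothety {n : ℕ+} {τ₁ τ₂ : ℍ} {α : ℂ} (hα : α ≠ 0)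
    (h : ∀ ω, ω ∈ (periods τ₁).lattice ↔ α * ω ∈ (periods τ₂).lattice)
    (h' : ∀ ω, ω ∈ (periods (mulTau n τ₁)).lattice ↔ α * ω ∈ (periods (mulTau n τ₂)).lattice) :
    MobiusEquiv (descent n τ₁) (descent n τ₂) := by
  refine ⟨scaling α hα, scaling α hα, fun x => ?_⟩
  obtain ⟨z, rfl⟩ := toSphere_surjective (periods τ₁) x
  rw [scaling_smul_toSphere hα h, sphereMap_descent, sphereMap_descent,
    scaling_smul_toSphere hα h', mul_left_comm]

theorem mem_periods_iff_mul_mem {τ₁ τ₂ : ℍ} {α : ℂ} (hα : α ≠ 0) {a b c d : ℤ}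
    (hdet : a * d - b * c = 1) (h1 : α = c * τ₂ + d) (h2 : α * τ₁ = a * τ₂ + b) (ω : ℂ) :
    ω ∈ (periods τ₁).lattice ↔ α * ω ∈ (periods τ₂).lattice := by
  have hdet : (a * d - b * c : ℂ) = 1 := by exact_mod_cast hdet
  rw [mem_periods_iff, mem_periods_iff]
  constructor
  · rintro ⟨x, y, rfl⟩
    refine ⟨x * d + y * b, x * c + y * a, ?_⟩
    push_cast
    linear_combination (x : ℂ) * h1 + (y : ℂ) * h2
  · rintro ⟨x, y, h⟩
    refine ⟨x * a - y * b, y * d - x * c, mul_left_cancel₀ hα ?_⟩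
    push_cast
    linear_combination h - (x * a - y * b : ℂ) * h1 - (y * d - x * c : ℂ) * h2 -
      (x + y * τ₂ : ℂ) * hdet

theorem mobiusEquiv_of_mem_orbit {n : ℕ+} {τ₁ τ₂ : ℍ}
    (h : τ₁ ∈ MulAction.orbit (CongruenceSubgroup.Gamma0 n) τ₂) :
    MobiusEquiv (descent n τ₁) (descent n τ₂) := by
  obtain ⟨⟨γ, hγ⟩, hγτ⟩ := h
  have hγτ : γ • τ₂ = τ₁ := hγτ
  rw [CongruenceSubgroup.Gamma0_mem, ZMod.intCast_zmod_eq_zero_iff_dvd] at hγ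
  obtain ⟨c, hc⟩ := hγ
  have hdet := γ.det_coe
  rw [Matrix.det_fin_two] at hdet
  have hcoe := congrArg (fun τ : ℍ => (τ : ℂ)) hγτ
  simp only [UpperHalfPlane.coe_specialLinearGroup_apply, algebraMap_int_eq, eq_intCast,
    Complex.ofReal_intCast] at hcoe
  have hα : ((γ 1 0 : ℤ) : ℂ) * τ₂ + (γ 1 1 : ℤ) ≠ 0 := by
    intro h0
    obtain ⟨h1, h2⟩ := add_mul_coe_inj (τ := τ₂) (a := (γ 1 1 : ℤ)) (b := (γ 1 0 : ℤ))
      (a' := 0) (b' := 0) (by push_cast; linear_combination h0)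
    have h1 : γ 1 1 = 0 := by exact_mod_cast h1
    have h2 : γ 1 0 = 0 := by exact_mod_cast h2
    rw [h1, h2] at hdet
    simp at hdet
  rw [div_eq_iff hα] at hcoe
  -- With lower left entry `n c`, the matrix `(a, n b; c, d)` sends `n τ₂` to `n τ₁` with the same
  -- factor `α = n c τ₂ + d`.
  refine mobiusEquiv_of_homothety hα
    (mem_periods_iff_mul_mem hα hdet rfl (by rw [mul_comm, ← hcoe]))
    (mem_periods_iff_mul_mem (a := γ 0 0) (b := n * γ 0 1) (c := c) (d := γ 1 1) hα ?_ ?_ ?_)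
  · linear_combination hdet + γ 0 1 * hc
  · rw [coe_mulTau, hc]
    push_cast
    ring
  · rw [coe_mulTau, coe_mulTau]
    push_cast
    linear_combination -(n : ℂ) * hcoe

/-! ### Classification by `Γ₀(n)`-orbits -/

theorem mobiusEquiv_descent_iff {n : ℕ+} (hn : 3 ≤ n) (τ₁ τ₂ : ℍ) :
    MobiusEquiv (descent n τ₁) (descent n τ₂) ↔
      MulAction.orbit (CongruenceSubgroup.Gamma0 n) τ₂ =
        MulAction.orbit (CongruenceSubgroup.Gamma0 n) τ₁ := by
  rw [eq_comm, MulAction.orbit_eq_iff]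
  constructor
  · intro h
    obtain ⟨α, h1, h2⟩ := exists_homothety_of_mobiusEquiv hn h
    exact mem_orbit_of_homothety h1 h2
  · exact mobiusEquiv_of_mem_orbit

/-- The map `Γ₀(n) τ ↦ [n_τ]`. -/
def descentClass (n : ℕ+) : Y0 n → ellipticClasses n :=
  Quotient.lift (fun τ => ⟨Quotient.mk mobiusSetoid (descent n τ), descent n τ,
    ⟨⟨n, τ, mobiusEquiv_equivalence.refl _⟩, ratDegree_descent n τ⟩, rfl⟩) fun _ _ h =>
      Subtype.ext (Quotient.sound (mobiusEquiv_of_mem_orbit h))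

theorem descentClass_bijective {n : ℕ+} (hn : 3 ≤ n) : Function.Bijective (descentClass n) := by
  constructor
  · rintro ⟨τ₁⟩ ⟨τ₂⟩ h
    have h := Quotient.exact (congrArg Subtype.val h)
    refine Quotient.sound ?_
    exact MulAction.orbit_eq_iff.1 ((mobiusEquiv_descent_iff hn τ₁ τ₂).1 h).symm
  · rintro ⟨_, f, ⟨⟨m, τ, hf⟩, hdeg⟩, rfl⟩
    -- An elliptic function of degree `n` is equivalent to some `m_τ`; invariance of the degree
    -- forces `m = n`.
    have hm : m = n := PNat.coe_injective (by
      rw [← hdeg, hf.ratDegree_eq, ratDegree_descent])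
    subst hm
    exact ⟨Quotient.mk _ τ, Subtype.ext (Quotient.sound (mobiusEquiv_equivalence.symm hf))⟩

end EllipticRational

end

theorem mainTheorem7 :
    -- `n_τ` exists, is unique and has degree `n`
    (∀ (n : ℕ+) (τ : ℍ),
      EllipticRational.IsDescent n τ (EllipticRational.descent n τ) ∧
      (∀ f : RatFunc ℂ, EllipticRational.IsDescent n τ f → f = EllipticRational.descent n τ) ∧
      EllipticRational.ratDegree (EllipticRational.descent n τ) = n) ∧
    ∀ n : ℕ+, 3 ≤ n →
      -- `n_{τ₁} ∼ n_{τ₂}` exactly when `Γ₀(n) τ₁ = Γ₀(n) τ₂`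
      (∀ τ₁ τ₂ : ℍ,
        EllipticRational.MobiusEquiv (EllipticRational.descent n τ₁)
            (EllipticRational.descent n τ₂) ↔
          MulAction.orbit (CongruenceSubgroup.Gamma0 n) τ₂ =
            MulAction.orbit (CongruenceSubgroup.Gamma0 n) τ₁) ∧
      -- `Γ₀(n) τ ↦ [n_τ]` is a bijection from `Y₀(n)` onto the classes of degree `n`
      ∃ Φ : EllipticRational.Y0 n ≃ EllipticRational.ellipticClasses n,
        ∀ τ : ℍ, (Φ (Quotient.mk _ τ) : Quotient EllipticRational.mobiusSetoid) =
          Quotient.mk _ (EllipticRational.descent n τ) := by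
  refine ⟨fun n τ => ⟨EllipticRational.isDescent_descent n τ, fun f hf => hf.eq_descent,
    EllipticRational.ratDegree_descent n τ⟩, fun n hn =>
    ⟨EllipticRational.mobiusEquiv_descent_iff hn,
      Equiv.ofBijective _ (EllipticRational.descentClass_bijective hn), fun τ => rfl⟩⟩
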